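/- Let $s\ge 1$. For $\delta_k\in\{0,1\}$, $w=(w_1,\dots,w_s)\in\mathbb C^s$ and $N_B\in\mathbb R$, the single-mode phase-insensitive bosonic Gaussian multiple-access channel (BGMAC) with symmetry types $\delta_k$, weights $w$ and dark photon number $N_B$ is the channel $\mathcal N$ from $s$ sender modes $A_1,\dots,A_s$ to one receiver mode $B$ that is obtained from a Gaussian unitary acting on the sender modes and two environment modes $E_1,E_2$ in the vacuum state, by discarding all output modes except $B$, where $$\hat a_B=\sum_{k=1}^s w_k\big((1-\delta_k)\hat a_{A_k}+\delta_k\hat a_{A_k}^\dagger\big)+u_1\hat a_{E_1}+u_2\hat a_{E_2}^\dagger ,$$ with $u_1,u_2\in\mathbb R$, $\sum_k(1-2\delta_k)|w_k|^2+u_1^2-u_2^2=1$ and $N_B=u_2^2+\sum_k|w_k|^2\delta_k$. It is global covariant if all $\delta_k=0$ and global contravariant if all $\delta_k=1$. For $s=1$ it is called a single-mode phase-insensitive bosonic Gaussian channel (BGC) with type $\delta$, coefficient $w$ and dark photon number $N_B$. An $s$-input-one-output beamsplitter with weights $v\in\mathbb C^s$ is the channel given by a passive linear optical unitary on $s$ modes,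 one of whose output modes is $\hat a_{\rm mix}=\sum_k v_k\hat a_{A_k}$, all other output modes being discarded. Write $|w|=\sqrt{\sum_k|w_k|^2}$. **Lemma.** (i) Every global covariant BGMAC $\mathcal N$ with weights $w$ and dark photon number $N_B$ is a covariant interference BGMAC: $\mathcal N=\Psi\circ\mathcal B$, where $\mathcal B$ is an $s$-input-one-output beamsplitter with weights $v$ satisfying $|w|\,v_k=w_k$ for all $k$, and $\Psi$ is the covariant ($\delta=0$) single-mode phase-insensitive BGC with coefficient $|w|$ and dark photon number $N_B$. (ii) Every global contravariant BGMAC $\mathcal N$ with weights $w$ and dark photon number $N_B$ is a contravariant interference BGMAC: $\mathcal N=\Psi\circ\mathcal B$, where $\mathcal B$ is an $s$-input-one-output beamsplitter with weights $v$ satisfying $|w|\,v_k=\overline{w_k}$ for all $k$, and $\Psi$ is the contravariant ($\delta=1$) single-mode phase-insensitive BGC with coefficient $|w|$ and dark photon number $N_B$. -/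

import Mathlib

open MeasureTheory
open scoped ComplexConjugate InnerProductSpace

noncomputable section

/-- The Hilbert space of bosonic modes labelled by `ι`, in the position (Schrödinger)
representation: square-integrable functions of the position quadratures. The annihilation
operator of mode `j` is `a_j = (x_j + ∂/∂x_j) / √2`. -/
abbrev ModeSpace (ι : Type) [Fintype ι] : Type := Lp ℂ 2 (volume : Measure (ι → ℝ))

/-! ### Product vectors, vacuum, Weyl operators -/

section Vectors

variable {ι κ : Type} [Fintype ι] [Fintype κ]

theorem memLp_tensor (f : ModeSpace ι) (g : ModeSpace κ) :
    MemLp (fun x : ι ⊕ κ → ℝ => f (fun i => x (Sum.inl i)) * g (fun k => x (Sum.inr k))) 2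
      volume := by
  have h : MemLp (fun p : (ι → ℝ) × (κ → ℝ) => f p.1 * g p.2) 2 (volume.prod volume) := by
    have hm : AEStronglyMeasurable (fun p : (ι → ℝ) × (κ → ℝ) => f p.1 * g p.2)
        (volume.prod volume) :=
      ((Lp.aestronglyMeasurable f).comp_fst).mul ((Lp.aestronglyMeasurable g).comp_snd)
    rw [memLp_two_iff_integrable_sq_norm hm]
    have := ((memLp_two_iff_integrable_sq_norm (Lp.aestronglyMeasurable f)).1
      (Lp.memLp f)).mul_prod ((memLp_two_iff_integrable_sq_norm
        (Lp.aestronglyMeasurable g)).1 (Lp.memLp g))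
    simpa [mul_pow] using this
  exact h.comp_measurePreserving (volume_measurePreserving_sumPiEquivProdPi fun _ : ι ⊕ κ => ℝ)

/-- The product vector `f ⊗ g`, as a vector of the joint system of the modes `ι` and `κ`. -/
def tensorVec (f : ModeSpace ι) (g : ModeSpace κ) : ModeSpace (ι ⊕ κ) :=
  (memLp_tensor f g).toLp _

theorem coeFn_tensorVec (f : ModeSpace ι) (g : ModeSpace κ) :
    tensorVec f g =ᵐ[volume]
      fun x => f (fun i => x (Sum.inl i)) * g (fun k => x (Sum.inr k)) :=
  MemLp.coeFn_toLp _

theorem quasiMeasurePreserving_inl :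
    Measure.QuasiMeasurePreserving (fun (x : ι ⊕ κ → ℝ) (i : ι) => x (Sum.inl i))
      volume volume :=
  Measure.quasiMeasurePreserving_fst.comp
    (volume_measurePreserving_sumPiEquivProdPi fun _ : ι ⊕ κ => ℝ).quasiMeasurePreserving

theorem norm_tensorVec (f : ModeSpace ι) (g : ModeSpace κ) :
    ‖tensorVec f g‖ = ‖f‖ * ‖g‖ := by
  have key : ∀ {α : Type} [Fintype α] (h : ModeSpace α),
      ‖h‖ ^ 2 = ∫ x, ‖h x‖ ^ 2 := by
    intro α _ h
    have := L2.inner_def (𝕜 := ℂ) h h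
    rw [inner_self_eq_norm_sq_to_K] at this
    have h2 : ∀ x, ⟪h x, h x⟫_ℂ = ((‖h x‖ ^ 2 : ℝ) : ℂ) := by
      intro x; rw [inner_self_eq_norm_sq_to_K]; push_cast; rfl
    simp only [h2] at this
    rw [integral_complex_ofReal] at this
    exact Complex.ofReal_injective (by simpa using this)
  have : ‖tensorVec f g‖ ^ 2 = (‖f‖ * ‖g‖) ^ 2 := by
    rw [mul_pow, key, key, key]
    rw [integral_congr_ae (g := fun x : ι ⊕ κ → ℝ =>
      ‖f (fun i => x (Sum.inl i))‖ ^ 2 * ‖g (fun k => x (Sum.inr k))‖ ^ 2)]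
    · rw [← integral_prod_mul (μ := (volume : Measure (ι → ℝ)))
        (ν := (volume : Measure (κ → ℝ)))]
      exact (volume_measurePreserving_sumPiEquivProdPi fun _ : ι ⊕ κ => ℝ).integral_comp'
        (fun p : (ι → ℝ) × (κ → ℝ) => ‖f p.1‖ ^ 2 * ‖g p.2‖ ^ 2)
    · filter_upwards [coeFn_tensorVec f g] with x hx
      rw [hx, norm_mul, mul_pow]
  exact (sq_eq_sq₀ (norm_nonneg _) (by positivity)).1 this

/-- Appending a system of modes `κ` in the state vector `g`: the map `f ↦ f ⊗ g`. -/
def tensorRight (ι : Type) [Fintype ι] (g : ModeSpace κ) :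
    ModeSpace ι →L[ℂ] ModeSpace (ι ⊕ κ) :=
  LinearMap.mkContinuous
    { toFun := fun f => tensorVec f g
      map_add' := fun f f' => by
        apply Lp.ext
        filter_upwards [coeFn_tensorVec (f + f') g, coeFn_tensorVec f g, coeFn_tensorVec f' g,
          Lp.coeFn_add (tensorVec f g) (tensorVec f' g),
          quasiMeasurePreserving_inl.ae (Lp.coeFn_add f f')] with x h1 h2 h3 h4 h5
        rw [h1, h4, Pi.add_apply, h2, h3, h5, Pi.add_apply, add_mul]
      map_smul' := fun c f => by
        apply Lp.ext
        filter_upwards [coeFn_tensorVec (c • f) g, coeFn_tensorVec f g,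
          Lp.coeFn_smul c (tensorVec f g),
          quasiMeasurePreserving_inl.ae (Lp.coeFn_smul c f)] with x h1 h2 h3 h4
        simp only [RingHom.id_apply]
        rw [h1, h3, Pi.smul_apply, h2, h4, Pi.smul_apply, smul_eq_mul, smul_eq_mul, mul_assoc] }
    ‖g‖ fun f => by
      simpa [mul_comm] using (norm_tensorVec f g).le

theorem memLp_vacuum (ι : Type) [Fintype ι] :
    MemLp (fun x : ι → ℝ =>
      ∏ j, (((Real.pi ^ (-(1 / 4) : ℝ) * Real.exp (-(x j) ^ 2 / 2) : ℝ)) : ℂ)) 2 volume := by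
  have hm : AEStronglyMeasurable (fun x : ι → ℝ =>
      ∏ j, (((Real.pi ^ (-(1 / 4) : ℝ) * Real.exp (-(x j) ^ 2 / 2) : ℝ)) : ℂ)) volume := by
    apply Continuous.aestronglyMeasurable
    fun_prop
  rw [memLp_two_iff_integrable_sq_norm hm]
  have h1 : Integrable (fun y : ℝ =>
      (Real.pi ^ (-(1 / 4) : ℝ)) ^ 2 * Real.exp (-1 * y ^ 2)) :=
    (integrable_exp_neg_mul_sq one_pos).const_mul _
  have := Integrable.fintype_prod (ι := ι) (μ := fun _ => volume) (fun _ => h1)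
  refine this.congr (Filter.Eventually.of_forall fun x => ?_)
  simp only [norm_prod, ← Finset.prod_pow]
  refine Finset.prod_congr rfl fun j _ => ?_
  rw [Complex.norm_real, Real.norm_eq_abs, sq_abs, mul_pow, ← Real.exp_nat_mul]
  congr 2
  push_cast
  ring

/-- The vacuum state vector of the modes `ι`, the product of the Gaussians
`π^(-1/4) exp(-x_j²/2)`. -/
def vacuum (ι : Type) [Fintype ι] : ModeSpace ι := (memLp_vacuum ι).toLp _

theorem memLp_weyl (z : ι → ℂ) (f : ModeSpace ι) :
    MemLp (fun x : ι → ℝ =>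
      Complex.exp (Complex.I * ((∑ j, (√2 * (z j).im * x j - (z j).re * (z j).im) : ℝ) : ℂ)) *
        f (fun j => x j - √2 * (z j).re)) 2 volume := by
  have h1 : MemLp (fun x : ι → ℝ => f (fun j => x j - √2 * (z j).re)) 2 volume :=
    (Lp.memLp f).comp_measurePreserving
      (measurePreserving_sub_right volume fun j => √2 * (z j).re)
  have hm : AEStronglyMeasurable (fun x : ι → ℝ =>
      Complex.exp (Complex.I *
        ((∑ j, (√2 * (z j).im * x j - (z j).re * (z j).im) : ℝ) : ℂ))) volume := by
    apply Continuous.aestronglyMeasurable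
    fun_prop
  refine h1.of_le (hm.mul h1.1) (Filter.Eventually.of_forall fun x => ?_)
  rw [norm_mul, mul_comm Complex.I, Complex.norm_exp_ofReal_mul_I, one_mul]

/-- The Weyl (displacement) operator `D(z) = exp (∑ j, (z_j a_j† - z̄_j a_j))`. With
`a_j = (x_j + i p_j) / √2` the exponent is `i √2 ∑ j, (Im z_j x_j - Re z_j p_j)`. -/
def weyl (z : ι → ℂ) (f : ModeSpace ι) : ModeSpace ι := (memLp_weyl z f).toLp _

end Vectors

/-! ### Quantum states and Gaussian dilations -/

/-- Density operators: positive operators of trace one. -/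
structure DensityOperator (H : Type) [NormedAddCommGroup H] [InnerProductSpace ℂ H]
    [CompleteSpace H] where
  op : H →L[ℂ] H
  pos : op.IsPositive
  hasTrace_one : ∀ (J : Type) (b : HilbertBasis J ℂ H), HasSum (fun j => ⟪b j, op (b j)⟫_ℂ) 1

/-- Maps from states of the modes `ι` to states of the modes `κ`. The predicates `IsBGMAC` and
`IsBeamsplitter` below single out maps given by a Stinespring dilation, which are completely
positive and trace preserving. -/
abbrev StateMap (ι κ : Type) [Fintype ι] [Fintype κ] : Type :=
  DensityOperator (ModeSpace ι) → DensityOperator (ModeSpace κ)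

section Dilations

variable {ι κ φ : Type} [Fintype ι] [Fintype κ] [Fintype φ]

/-- The unitary `U` implements the Bogoliubov transform
`U† a_i U = ∑ j, (P i j a_j + Q i j a_j†)` (with `i` an output and `j` an input mode).
It is written in the exponentiated (Weyl) form
`D(z) U = U exp (∑ i, (z_i b_i† - z̄_i b_i))` where `b_i = ∑ j, (P i j a_j + Q i j a_j†)`;
the coefficient of `a_j†` in the exponent is `∑ i, (z_i conj (P i j) - z̄_i Q i j)`. -/
def ImplementsBogoliubov (U : ModeSpace ι ≃ₗᵢ[ℂ] ModeSpace κ) (P Q : Matrix κ ι ℂ) : Prop :=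
  ∀ (z : κ → ℂ) (f : ModeSpace ι),
    weyl z (U f) = U (weyl (fun j => ∑ i, (z i * conj (P i j) - conj (z i) * Q i j)) f)

/-- `N ρ = Tr_φ (W ρ W†)` for all states `ρ`: `N` has the Stinespring dilation `W`, and the modes
`φ` are discarded. The matrix element `⟪x, Tr_φ T y⟫` is `∑ j, ⟪x ⊗ e_j, T (y ⊗ e_j)⟫` for an
orthonormal basis `e` of the discarded system. -/
def HasDilation (N : StateMap ι κ) (W : ModeSpace ι →L[ℂ] ModeSpace (κ ⊕ φ)) : Prop :=
  ∀ (ρ : DensityOperator (ModeSpace ι)) (J : Type) (e : HilbertBasis J ℂ (ModeSpace φ))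
    (x y : ModeSpace κ),
    HasSum (fun j => ⟪tensorVec x (e j), (W ∘L ρ.op ∘L W.adjoint) (tensorVec y (e j))⟫_ℂ)
      ⟪x, (N ρ).op y⟫_ℂ

end Dilations

/-! ### Channels -/

/-- `N` is the single-mode phase-insensitive bosonic Gaussian multiple-access channel with `s`
senders, weights `w`, symmetry types `δ` (`0` covariant, `1` contravariant) and dark photon number
`NB`. Its input-output relation is
`a_B = ∑ k, w_k ((1 - δ_k) a_{A_k} + δ_k a_{A_k}†) + u₁ a_{E,1} + u₂ a_{E,2}†`,
realized by a Gaussian unitary on the `s` sender modes and two environment modes `E` in vacuum;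
of the output modes, one is the receiver's mode `B` and the others are discarded. -/
def IsBGMAC {s : ℕ} (δ : Fin s → Fin 2) (w : Fin s → ℂ) (NB : ℝ)
    (N : StateMap (Fin s) (Fin 1)) : Prop :=
  ∃ (u₁ u₂ : ℝ) (m : ℕ)
    (U : ModeSpace (Fin s ⊕ Fin 2) ≃ₗᵢ[ℂ] ModeSpace (Fin 1 ⊕ Fin m))
    (P Q : Matrix (Fin 1 ⊕ Fin m) (Fin s ⊕ Fin 2) ℂ),
    -- the commutation relation `[a_B, a_B†] = 1`
    ∑ k, (1 - 2 * ((δ k : ℕ) : ℝ)) * ‖w k‖ ^ 2 + (u₁ ^ 2 - u₂ ^ 2) = 1 ∧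
    -- the mean photon number of the output on vacuum inputs
    NB = u₂ ^ 2 + ∑ k, ‖w k‖ ^ 2 * ((δ k : ℕ) : ℝ) ∧
    -- the row of the Bogoliubov transform that belongs to `B`
    (∀ k, P (Sum.inl 0) (Sum.inl k) = w k * (1 - ((δ k : ℕ) : ℂ))) ∧
    (∀ k, Q (Sum.inl 0) (Sum.inl k) = w k * ((δ k : ℕ) : ℂ)) ∧
    P (Sum.inl 0) (Sum.inr 0) = u₁ ∧ P (Sum.inl 0) (Sum.inr 1) = 0 ∧
    Q (Sum.inl 0) (Sum.inr 0) = 0 ∧ Q (Sum.inl 0) (Sum.inr 1) = u₂ ∧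
    ImplementsBogoliubov U P Q ∧
    HasDilation N
      (U.toLinearIsometry.toContinuousLinearMap ∘L tensorRight (Fin s) (vacuum (Fin 2)))

/-- The single-mode phase-insensitive bosonic Gaussian channel
`a_B = c ((1 - δ) a_A + δ a_A†) + u₁ a_{E,1} + u₂ a_{E,2}†` with dark photon number `NB`. -/
def IsBGC (δ : Fin 2) (c : ℂ) (NB : ℝ) (Ψ : StateMap (Fin 1) (Fin 1)) : Prop :=
  IsBGMAC (fun _ => δ) (fun _ => c) NB Ψ

/-- `B` is an `s`-input-one-output beamsplitter with output mode `a_mix = ∑ k, v_k a_{A_k}`: a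
passive linear optical network (`a_i ↦ ∑ k, P i k a_k` with `P` unitary) of which all output
ports but one are discarded. -/
def IsBeamsplitter {s : ℕ} (v : Fin s → ℂ) (B : StateMap (Fin s) (Fin 1)) : Prop :=
  ∃ (m : ℕ) (U : ModeSpace (Fin s) ≃ₗᵢ[ℂ] ModeSpace (Fin 1 ⊕ Fin m))
    (P : Matrix (Fin 1 ⊕ Fin m) (Fin s) ℂ),
    P * P.conjTranspose = 1 ∧ P.conjTranspose * P = 1 ∧
    (∀ k, P (Sum.inl 0) k = v k) ∧
    ImplementsBogoliubov U P 0 ∧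
    HasDilation B U.toLinearIsometry.toContinuousLinearMap

/-- `N` is the interference BGMAC `Ψ ∘ B`: the inputs are mixed on a beamsplitter `B` into
`a_mix = ∑ k, v_k a_{A_k}`, which then passes through the single-mode phase-insensitive channel
`Ψ` of type `δ`, coefficient `c` and dark photon number `NB`. It is called covariant for `δ = 0`
and contravariant for `δ = 1`. -/
def IsInterferenceBGMAC {s : ℕ} (δ : Fin 2) (v : Fin s → ℂ) (c : ℂ) (NB : ℝ)
    (N : StateMap (Fin s) (Fin 1)) : Prop :=
  ∃ (B : StateMap (Fin s) (Fin 1)) (Ψ : StateMap (Fin 1) (Fin 1)),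
    IsBeamsplitter v B ∧ IsBGC δ c NB Ψ ∧ N = Ψ ∘ B

end

/-!
A phase-insensitive Gaussian channel `N` with all senders of the same symmetry type sees its inputs
only through the mode `∑ k, w_k a_k` (covariant case), or through the adjoint of `∑ k, w̄_k a_k`
(contravariant case). So mixing the inputs into this mode divided by `|w|` first, and then applying
the single-mode channel with coefficient `|w|` and the same environment coefficients `u₁`, `u₂`,
gives the same input-output relation. The proof makes this precise in three steps.

*A state is determined by its characteristic function* `z ↦ Tr (ρ D(z))`
(`DensityOperator.ext_charFn`). Writing `ρ = X X†` with `X` Hilbert–Schmidt, the difference of two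
states becomes a series of rank-one operators with an integral kernel; on each translate of the
diagonal, the vanishing of the characteristic function says that the Fourier transform of the kernel
is zero, so the kernel is zero by injectivity of the Fourier transform on `L¹` and Fubini.

*A Gaussian dilation acts on characteristic functions by a linear substitution*
(`HasDilation.charFn_eq`, `charFn_of_gaussian_dilation`): the commutation rule `D(z) U = U D(z')`
gives `Tr (N(ρ) D(z)) = ⟨0|D(z'_E)|0⟩ Tr (ρ D(z'_A))`, where `z'` involves only the row of the
Bogoliubov transform that belongs to the output mode. Hence the channel does not depend on the rest
of the dilation, and comparing the substitutions for `N`, `Ψ` and `B` gives `N = Ψ ∘ B`.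

*The beamsplitter `B` and the channel `Ψ` exist* (`exists_isBeamsplitter`, `exists_isBGC`). A
dilation by an isometry defines a map of states, because the partial trace of a trace-class operator
exists (`exists_partialTrace`). The unitaries come from the Schrödinger representation: linear
changes of the position coordinates implement real orthogonal networks and all transformations with
real Bogoliubov coefficients, which suffices for `Ψ`; phase rotations are products of shears
`exp (i t x² / 2)` and their Fourier conjugates. A network with first row `v` is a phase rotation
followed by a real orthogonal matrix.
-/

set_option linter.unusedSectionVars false

noncomputable section

/-! ### Hilbert–Schmidt operators and the trace pairing -/

section HilbertSchmidt

variable {H K L : Type} [NormedAddCommGroup H] [InnerProductSpace ℂ H] [CompleteSpace H]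
  [NormedAddCommGroup K] [InnerProductSpace ℂ K] [CompleteSpace K]
  [NormedAddCommGroup L] [InnerProductSpace ℂ L] [CompleteSpace L]

theorem HilbertBasis.hasSum_norm_inner_sq {J : Type} (b : HilbertBasis J ℂ H) (x : H) :
    HasSum (fun j => ‖⟪b j, x⟫_ℂ‖ ^ 2) (‖x‖ ^ 2) := by
  have h := b.hasSum_inner_mul_inner x x
  rw [inner_self_eq_norm_sq_to_K] at h
  have h2 : (fun j => ⟪x, b j⟫_ℂ * ⟪b j, x⟫_ℂ) =
      fun j => ((‖⟪b j, x⟫_ℂ‖ ^ 2 : ℝ) : ℂ) := by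
    ext j
    rw [← inner_conj_symm x (b j), mul_comm, Complex.mul_conj, Complex.normSq_eq_norm_sq]
  rw [h2] at h
  exact Complex.hasSum_ofReal.1 (by simpa using h)

/-- `X` is Hilbert–Schmidt with squared Hilbert–Schmidt norm `c`. By
`HasHSNormSq.of_basis` it is enough to check the defining sum on a single orthonormal basis. -/
def HasHSNormSq (X : H →L[ℂ] K) (c : ℝ) : Prop :=
  ∀ (J : Type) (b : HilbertBasis J ℂ H), HasSum (fun j => ‖X (b j)‖ ^ 2) c

/-- The double series behind the symmetry `‖X‖_HS = ‖X†‖_HS`. -/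
theorem hasSum_norm_sq_adjoint {J J' : Type} {X : H →L[ℂ] K} {c : ℝ} (b : HilbertBasis J ℂ H)
    (f : HilbertBasis J' ℂ K) (h : HasSum (fun j => ‖X (b j)‖ ^ 2) c) :
    HasSum (fun p : J × J' => ‖⟪f p.2, X (b p.1)⟫_ℂ‖ ^ 2) c ∧
      HasSum (fun k => ‖X.adjoint (f k)‖ ^ 2) c := by
  have hs : Summable (fun p : J × J' => ‖⟪f p.2, X (b p.1)⟫_ℂ‖ ^ 2) := by
    rw [summable_prod_of_nonneg (fun _ => by positivity)]
    have h0 := fun j => f.hasSum_norm_inner_sq (X (b j))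
    refine ⟨fun j => (h0 j).summable, ?_⟩
    have h3 : (fun j => ∑' k, ‖⟪f k, X (b j)⟫_ℂ‖ ^ 2) = fun j => ‖X (b j)‖ ^ 2 :=
      funext fun j => (h0 j).tsum_eq
    exact h3 ▸ h.summable
  have h1 : HasSum (fun p : J × J' => ‖⟪f p.2, X (b p.1)⟫_ℂ‖ ^ 2) c := by
    have := HasSum.prod_fiberwise (g := fun j => ‖X (b j)‖ ^ 2) hs.hasSum
      (fun j => f.hasSum_norm_inner_sq (X (b j)))
    rw [h.unique this]
    exact hs.hasSum
  refine ⟨h1, ?_⟩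
  have h2 : HasSum (fun p : J' × J => ‖⟪f p.1, X (b p.2)⟫_ℂ‖ ^ 2) c :=
    (Equiv.prodComm J' J).hasSum_iff.2 h1
  refine HasSum.prod_fiberwise (g := fun k => ‖X.adjoint (f k)‖ ^ 2) h2 fun k => ?_
  have h3 := b.hasSum_norm_inner_sq (X.adjoint (f k))
  simp only [ContinuousLinearMap.adjoint_inner_right] at h3
  simpa only [norm_inner_symm (f k)] using h3

theorem HasHSNormSq.of_basis {J : Type} {X : H →L[ℂ] K} {c : ℝ} (b : HilbertBasis J ℂ H)
    (h : HasSum (fun j => ‖X (b j)‖ ^ 2) c) : HasHSNormSq X c := by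
  intro J' b'
  obtain ⟨w, f, -⟩ := exists_hilbertBasis ℂ K
  have := (hasSum_norm_sq_adjoint f b' (hasSum_norm_sq_adjoint b f h).2).2
  simpa using this

theorem HasHSNormSq.adjoint {X : H →L[ℂ] K} {c : ℝ} (h : HasHSNormSq X c) :
    HasHSNormSq X.adjoint c := by
  obtain ⟨w, b, -⟩ := exists_hilbertBasis ℂ H
  exact fun J f => (hasSum_norm_sq_adjoint b f (h _ b)).2

theorem HasHSNormSq.isometry_comp {X : H →L[ℂ] K} {c : ℝ} (h : HasHSNormSq X c)
    {W : K →L[ℂ] L} (hW : ∀ x, ‖W x‖ = ‖x‖) : HasHSNormSq (W ∘L X) c := by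
  intro J b
  simpa [hW] using h J b

theorem HasHSNormSq.exists_comp {X : H →L[ℂ] K} {c : ℝ} (h : HasHSNormSq X c)
    (A : K →L[ℂ] L) : ∃ c', HasHSNormSq (A ∘L X) c' := by
  obtain ⟨w, b, -⟩ := exists_hilbertBasis ℂ H
  have hs : Summable fun j => ‖(A ∘L X) (b j)‖ ^ 2 := by
    refine Summable.of_nonneg_of_le (fun _ => by positivity) (fun j => ?_)
      ((h _ b).summable.mul_left (‖A‖ ^ 2))
    rw [← mul_pow]
    exact pow_le_pow_left₀ (norm_nonneg _) (A.le_opNorm _) 2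
  exact ⟨_, .of_basis b hs.hasSum⟩

theorem HasHSNormSq.exists_precomp {X : H →L[ℂ] K} {c : ℝ} (h : HasHSNormSq X c)
    (A : L →L[ℂ] H) : ∃ c', HasHSNormSq (X ∘L A) c' := by
  obtain ⟨c', hc⟩ := h.adjoint.exists_comp A.adjoint
  refine ⟨c', ?_⟩
  have := hc.adjoint
  rwa [ContinuousLinearMap.adjoint_comp, ContinuousLinearMap.adjoint_adjoint,
    ContinuousLinearMap.adjoint_adjoint] at this

theorem norm_sq_le_of_hasSum {J : Type} (b : HilbertBasis J ℂ H) {X : H →L[ℂ] K} {c : ℝ}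
    (h : HasSum (fun j => ‖X (b j)‖ ^ 2) c) : ‖X‖ ^ 2 ≤ c := by
  have hc : 0 ≤ c := h.nonneg fun _ => by positivity
  have key : ‖X.adjoint‖ ≤ √c := by
    refine ContinuousLinearMap.opNorm_le_bound _ (Real.sqrt_nonneg _) fun y => ?_
    refine abs_le_of_sq_le_sq' ?_ (by positivity) |>.2
    rw [mul_pow, Real.sq_sqrt hc]
    refine hasSum_le (fun j => ?_) (b.hasSum_norm_inner_sq (X.adjoint y)) (h.mul_right (‖y‖ ^ 2))
    rw [ContinuousLinearMap.adjoint_inner_right, ← mul_pow]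
    exact pow_le_pow_left₀ (norm_nonneg _) (norm_inner_le_norm _ _) 2
  rw [LinearIsometryEquiv.norm_map] at key
  calc ‖X‖ ^ 2 ≤ √c ^ 2 := pow_le_pow_left₀ (norm_nonneg _) key 2
    _ = c := Real.sq_sqrt hc

/-- The Hilbert–Schmidt pairing `Tr (X† Y)` can be computed as `Tr (Y X†)`; both series converge
in every pair of orthonormal bases. -/
theorem exists_hasSum_inner {X Y : H →L[ℂ] K} {c d : ℝ} (hX : HasHSNormSq X c)
    (hY : HasHSNormSq Y d) :
    ∃ t : ℂ, (∀ (J : Type) (b : HilbertBasis J ℂ H), HasSum (fun j => ⟪X (b j), Y (b j)⟫_ℂ) t) ∧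
      ∀ (J : Type) (f : HilbertBasis J ℂ K),
        HasSum (fun k => ⟪Y.adjoint (f k), X.adjoint (f k)⟫_ℂ) t := by
  have key : ∀ (J J' : Type) (b : HilbertBasis J ℂ H) (f : HilbertBasis J' ℂ K), ∃ t : ℂ,
      HasSum (fun j => ⟪X (b j), Y (b j)⟫_ℂ) t ∧
        HasSum (fun k => ⟪Y.adjoint (f k), X.adjoint (f k)⟫_ℂ) t := by
    intro J J' b f
    have hs : Summable fun p : J × J' => ⟪X (b p.1), f p.2⟫_ℂ * ⟪f p.2, Y (b p.1)⟫_ℂ := by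
      refine Summable.of_norm_bounded (((hasSum_norm_sq_adjoint b f (hX _ b)).1.summable.add
        (hasSum_norm_sq_adjoint b f (hY _ b)).1.summable)) fun p => ?_
      rw [norm_mul, norm_inner_symm]
      nlinarith [sq_nonneg (‖⟪f p.2, X (b p.1)⟫_ℂ‖ - ‖⟪f p.2, Y (b p.1)⟫_ℂ‖),
        sq_nonneg (‖⟪f p.2, X (b p.1)⟫_ℂ‖), sq_nonneg ‖⟪f p.2, Y (b p.1)⟫_ℂ‖]
    obtain ⟨t, ht⟩ := hs
    have ht' : HasSum (fun p : J' × J => ⟪X (b p.2), f p.1⟫_ℂ * ⟪f p.1, Y (b p.2)⟫_ℂ) t :=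
      (Equiv.prodComm J' J).hasSum_iff.2 ht
    refine ⟨t, HasSum.prod_fiberwise (g := fun j => ⟪X (b j), Y (b j)⟫_ℂ) ht
      fun j => f.hasSum_inner_mul_inner (X (b j)) (Y (b j)),
      HasSum.prod_fiberwise (g := fun k => ⟪Y.adjoint (f k), X.adjoint (f k)⟫_ℂ) ht' fun k => ?_⟩
    have h3 := b.hasSum_inner_mul_inner (Y.adjoint (f k)) (X.adjoint (f k))
    have h4 : ∀ j, ⟪Y.adjoint (f k), b j⟫_ℂ * ⟪b j, X.adjoint (f k)⟫_ℂ =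
        ⟪X (b j), f k⟫_ℂ * ⟪f k, Y (b j)⟫_ℂ := fun j => by
      rw [ContinuousLinearMap.adjoint_inner_right, ContinuousLinearMap.adjoint_inner_left, mul_comm]
    simpa only [h4] using h3
  obtain ⟨w, b, -⟩ := exists_hilbertBasis ℂ H
  obtain ⟨w', f, -⟩ := exists_hilbertBasis ℂ K
  obtain ⟨t, h1, h2⟩ := key _ _ b f
  refine ⟨t, fun J b' => ?_, fun J f' => ?_⟩
  · obtain ⟨t', h1', h2'⟩ := key _ _ b' f
    rwa [h2.unique h2']
  · obtain ⟨t', h1', h2'⟩ := key _ _ b f'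
    rwa [h1.unique h1']

/-- Cyclicity of the trace in the form used throughout: if `X` is Hilbert–Schmidt then
`Tr (X X† A) = Tr (X† A X)`. -/
theorem exists_hasSum_trace {X : K →L[ℂ] H} {c : ℝ} (hX : HasHSNormSq X c) (A : H →L[ℂ] H) :
    ∃ t : ℂ,
      (∀ (J : Type) (b : HilbertBasis J ℂ H),
        HasSum (fun j => ⟪b j, (X ∘L X.adjoint) (A (b j))⟫_ℂ) t) ∧
      ∀ (J : Type) (f : HilbertBasis J ℂ K), HasSum (fun k => ⟪X (f k), A (X (f k))⟫_ℂ) t := by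
  obtain ⟨d, hd⟩ := hX.adjoint.exists_precomp A
  obtain ⟨t, h1, h2⟩ := exists_hasSum_inner hX.adjoint hd
  refine ⟨t, fun J b => ?_, fun J f => ?_⟩
  · simpa [ContinuousLinearMap.adjoint_inner_left] using h1 J b
  · simpa [ContinuousLinearMap.adjoint_comp, ContinuousLinearMap.adjoint_inner_left] using h2 J f

/-- A density operator factors as `ρ = X X†` with `X` of Hilbert–Schmidt norm one. -/
theorem DensityOperator.exists_factor (ρ : DensityOperator H) :
    ∃ X : H →L[ℂ] H, ρ.op = X ∘L X.adjoint ∧ HasHSNormSq X 1 := by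
  obtain ⟨X, hX⟩ := CStarAlgebra.nonneg_iff_eq_mul_star_self.1
    ((ContinuousLinearMap.nonneg_iff_isPositive _).2 ρ.pos)
  have hX' : ρ.op = X ∘L X.adjoint := hX
  refine ⟨X, hX', ?_⟩
  have : HasHSNormSq X.adjoint 1 := by
    intro J b
    have h := ρ.hasTrace_one J b
    have h2 : (fun j => ⟪b j, ρ.op (b j)⟫_ℂ) = fun j => ((‖X.adjoint (b j)‖ ^ 2 : ℝ) : ℂ) := by
      ext j
      rw [hX', ContinuousLinearMap.comp_apply, ← ContinuousLinearMap.adjoint_inner_left,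
        inner_self_eq_norm_sq_to_K]
      simp
    rw [h2] at h
    exact Complex.hasSum_ofReal.1 (by simpa using h)
  simpa using this.adjoint

theorem DensityOperator.ext_op {ρ σ : DensityOperator H} (h : ρ.op = σ.op) : ρ = σ := by
  cases ρ; cases σ; congr

end HilbertSchmidt

/-! ### Weighted composition operators -/

section WeightedComposition

open scoped NNReal ENNReal

variable {X Y : Type} [MeasurableSpace X] [MeasurableSpace Y] {μ : Measure X} {ν : Measure Y}
  {φ : Y → X} {m : Y → ℂ}

/-- The weight `m` and the map `φ` define an isometry `f ↦ m · (f ∘ φ)` of `L²` spaces: `φ` scales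
the measure by a constant and `m` has the constant modulus that compensates this. -/
structure IsometricWeight (μ : Measure X) (ν : Measure Y) (φ : Y → X) (m : Y → ℂ) : Prop where
  measurable_map : Measurable φ
  measurable_weight : Measurable m
  exists_norm_eq : ∃ k : ℝ≥0, k ≠ 0 ∧ (∀ y, ‖m y‖ = k) ∧ Measure.map φ ν = (k ^ 2)⁻¹ • μ

namespace IsometricWeight

theorem quasiMeasurePreserving (h : IsometricWeight μ ν φ m) :
    Measure.QuasiMeasurePreserving φ ν μ := by
  obtain ⟨k, -, -, h2⟩ := h.exists_norm_eq
  exact ⟨h.measurable_map, h2 ▸ Measure.smul_absolutelyContinuous⟩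

theorem eLpNorm_eq (h : IsometricWeight μ ν φ m) {f : X → ℂ} (hf : AEStronglyMeasurable f μ) :
    eLpNorm (fun y => m y * f (φ y)) 2 ν = eLpNorm f 2 μ := by
  obtain ⟨k, hk, h1, h2⟩ := h.exists_norm_eq
  have e1 : eLpNorm (fun y => m y * f (φ y)) 2 ν = eLpNorm ((k : ℝ) • (f ∘ φ)) 2 ν := by
    refine eLpNorm_congr_norm_ae (Filter.Eventually.of_forall fun y => ?_)
    simp [h1]
  have hf' : AEStronglyMeasurable f (Measure.map φ ν) := by
    rw [h2]; exact hf.mono_ac Measure.smul_absolutelyContinuous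
  rw [e1, eLpNorm_const_smul, ← eLpNorm_map_measure hf' h.measurable_map.aemeasurable, h2]
  rw [eLpNorm_smul_measure_of_ne_zero' (by simp [hk])]
  have e2 : ((k ^ 2)⁻¹ : ℝ≥0) ^ ((2 : ℝ≥0∞).toReal⁻¹) = k⁻¹ := by
    rw [← inv_pow, ← NNReal.rpow_natCast, ← NNReal.rpow_mul]
    simp
  rw [e2, ENNReal.smul_def, smul_eq_mul, ← mul_assoc]
  have e3 : ‖(k : ℝ)‖ₑ = (k : ℝ≥0∞) := by simp
  rw [e3, ← ENNReal.coe_mul, mul_inv_cancel₀ hk, ENNReal.coe_one, one_mul]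

theorem memLp (h : IsometricWeight μ ν φ m) (f : Lp ℂ 2 μ) :
    MemLp (fun y => m y * f (φ y)) 2 ν := by
  refine ⟨h.measurable_weight.aestronglyMeasurable.mul
    ((Lp.aestronglyMeasurable f).comp_quasiMeasurePreserving h.quasiMeasurePreserving), ?_⟩
  rw [h.eLpNorm_eq (Lp.aestronglyMeasurable f)]
  exact Lp.eLpNorm_lt_top f

/-- The isometry `f ↦ m · (f ∘ φ)`. -/
def toIsometry (h : IsometricWeight μ ν φ m) : Lp ℂ 2 μ →ₗᵢ[ℂ] Lp ℂ 2 ν where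
  toFun f := (h.memLp f).toLp _
  map_add' f g := by
    apply Lp.ext
    filter_upwards [(h.memLp (f + g)).coeFn_toLp, (h.memLp f).coeFn_toLp, (h.memLp g).coeFn_toLp,
      Lp.coeFn_add ((h.memLp f).toLp _) ((h.memLp g).toLp _),
      h.quasiMeasurePreserving.ae (Lp.coeFn_add f g)] with y h1 h2 h3 h4 h5
    rw [h1, h4, Pi.add_apply, h2, h3, h5, Pi.add_apply, mul_add]
  map_smul' c f := by
    apply Lp.ext
    filter_upwards [(h.memLp (c • f)).coeFn_toLp, (h.memLp f).coeFn_toLp,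
      Lp.coeFn_smul c ((h.memLp f).toLp _),
      h.quasiMeasurePreserving.ae (Lp.coeFn_smul c f)] with y h1 h2 h3 h4
    simp only [RingHom.id_apply]
    rw [h1, h3, Pi.smul_apply, h2, h4, Pi.smul_apply, smul_eq_mul, smul_eq_mul, mul_left_comm]
  norm_map' f := by
    simp only [LinearMap.coe_mk, AddHom.coe_mk]
    rw [Lp.norm_toLp, h.eLpNorm_eq (Lp.aestronglyMeasurable f), Lp.norm_def]

theorem coeFn_toIsometry (h : IsometricWeight μ ν φ m) (f : Lp ℂ 2 μ) :
    h.toIsometry f =ᵐ[ν] fun y => m y * f (φ y) :=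
  (h.memLp f).coeFn_toLp

variable {φ' : X → Y} {m' : X → ℂ}

/-- The unitary `f ↦ m · (f ∘ φ)`, given a weighted composition operator that is right inverse
to it. -/
def toUnitary (h : IsometricWeight μ ν φ m) (h' : IsometricWeight ν μ φ' m')
    (hφ : ∀ y, φ' (φ y) = y) (hm : ∀ y, m y * m' (φ y) = 1) : Lp ℂ 2 μ ≃ₗᵢ[ℂ] Lp ℂ 2 ν :=
  LinearIsometryEquiv.ofSurjective h.toIsometry fun g => ⟨h'.toIsometry g, by
    apply Lp.ext
    filter_upwards [h.coeFn_toIsometry (h'.toIsometry g),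
      h.quasiMeasurePreserving.ae (h'.coeFn_toIsometry g)] with y h1 h2
    rw [h1, h2, ← mul_assoc, hm, hφ, one_mul]⟩

theorem coeFn_toUnitary (h : IsometricWeight μ ν φ m) (h' : IsometricWeight ν μ φ' m')
    (hφ : ∀ y, φ' (φ y) = y) (hm : ∀ y, m y * m' (φ y) = 1) (f : Lp ℂ 2 μ) :
    h.toUnitary h' hφ hm f =ᵐ[ν] fun y => m y * f (φ y) :=
  h.coeFn_toIsometry f

end IsometricWeight

end WeightedComposition

/-! ### Weyl operators and product vectors -/

section WeylOperators

variable {ι κ : Type} [Fintype ι] [Fintype κ]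

/-- The phase factor of the Weyl operator `D(z)` in the position representation. -/
def weylPhase (z : ι → ℂ) (x : ι → ℝ) : ℂ :=
  Complex.exp (Complex.I * ((∑ j, (√2 * (z j).im * x j - (z j).re * (z j).im) : ℝ) : ℂ))

theorem coeFn_weyl (z : ι → ℂ) (f : ModeSpace ι) :
    weyl z f =ᵐ[volume] fun x => weylPhase z x * f (fun j => x j - √2 * (z j).re) :=
  MemLp.coeFn_toLp _

theorem isometricWeight_weyl (z : ι → ℂ) :
    IsometricWeight (volume : Measure (ι → ℝ)) volume (fun x j => x j - √2 * (z j).re)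
      (weylPhase z) := by
  have hp := measurePreserving_sub_right (volume : Measure (ι → ℝ)) fun j => √2 * (z j).re
  refine ⟨hp.measurable, ?_, 1, one_ne_zero, fun y => ?_, ?_⟩
  · unfold weylPhase
    fun_prop
  · rw [weylPhase, mul_comm, Complex.norm_exp_ofReal_mul_I, NNReal.coe_one]
  · rw [one_pow, inv_one, one_smul]
    exact hp.map_eq

/-- The Weyl operator as a linear isometry. -/
def weylIsometry (z : ι → ℂ) : ModeSpace ι →ₗᵢ[ℂ] ModeSpace ι := (isometricWeight_weyl z).toIsometry

theorem weylIsometry_apply (z : ι → ℂ) (f : ModeSpace ι) : weylIsometry z f = weyl z f := by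
  apply Lp.ext
  filter_upwards [(isometricWeight_weyl z).coeFn_toIsometry f, coeFn_weyl z f] with x h1 h2
  rw [h2]
  exact h1

theorem weyl_zero (f : ModeSpace ι) : weyl 0 f = f := by
  apply Lp.ext
  filter_upwards [coeFn_weyl 0 f] with x h1
  rw [h1]
  simp [weylPhase]

theorem quasiMeasurePreserving_inr :
    Measure.QuasiMeasurePreserving (fun (x : ι ⊕ κ → ℝ) (k : κ) => x (Sum.inr k))
      volume volume :=
  Measure.quasiMeasurePreserving_snd.comp
    (volume_measurePreserving_sumPiEquivProdPi fun _ : ι ⊕ κ => ℝ).quasiMeasurePreserving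

/-- Weyl operators act on product vectors factor by factor. -/
theorem weyl_tensorVec (z : ι ⊕ κ → ℂ) (f : ModeSpace ι) (g : ModeSpace κ) :
    weyl z (tensorVec f g) =
      tensorVec (weyl (fun i => z (Sum.inl i)) f) (weyl (fun k => z (Sum.inr k)) g) := by
  apply Lp.ext
  filter_upwards [coeFn_weyl z (tensorVec f g),
    (isometricWeight_weyl z).quasiMeasurePreserving.ae (coeFn_tensorVec f g),
    coeFn_tensorVec (weyl (fun i => z (Sum.inl i)) f) (weyl (fun k => z (Sum.inr k)) g),
    quasiMeasurePreserving_inl.ae (coeFn_weyl (fun i => z (Sum.inl i)) f),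
    quasiMeasurePreserving_inr.ae (coeFn_weyl (fun k => z (Sum.inr k)) g)] with x h1 h2 h3 h4 h5
  rw [h1, h2, h3, h4, h5]
  have : weylPhase z x = weylPhase (fun i => z (Sum.inl i)) (fun i => x (Sum.inl i)) *
      weylPhase (fun k => z (Sum.inr k)) (fun k => x (Sum.inr k)) := by
    unfold weylPhase
    rw [← Complex.exp_add, ← mul_add, ← Complex.ofReal_add, Fintype.sum_sum_type]
  rw [this]
  ring

theorem inner_tensorVec (f f' : ModeSpace ι) (g g' : ModeSpace κ) :
    ⟪tensorVec f g, tensorVec f' g'⟫_ℂ = ⟪f, f'⟫_ℂ * ⟪g, g'⟫_ℂ := by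
  rw [L2.inner_def, L2.inner_def, L2.inner_def,
    ← integral_prod_mul (μ := (volume : Measure (ι → ℝ))) (ν := (volume : Measure (κ → ℝ))),
    ← Measure.volume_eq_prod]
  refine Eq.trans ?_
    ((volume_measurePreserving_sumPiEquivProdPi fun _ : ι ⊕ κ => ℝ).integral_comp'
      (fun p : (ι → ℝ) × (κ → ℝ) => ⟪f p.1, f' p.1⟫_ℂ * ⟪g p.2, g' p.2⟫_ℂ))
  refine integral_congr_ae ?_
  filter_upwards [coeFn_tensorVec f g, coeFn_tensorVec f' g'] with x h1 h2
  rw [h1, h2]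
  simp only [RCLike.inner_apply, map_mul]
  change _ = f' (fun i => x (Sum.inl i)) * conj (f (fun i => x (Sum.inl i))) *
    (g' (fun k => x (Sum.inr k)) * conj (g (fun k => x (Sum.inr k))))
  ring

theorem tensorVec_add_right (f : ModeSpace ι) (g g' : ModeSpace κ) :
    tensorVec f (g + g') = tensorVec f g + tensorVec f g' := by
  apply Lp.ext
  filter_upwards [coeFn_tensorVec f (g + g'), coeFn_tensorVec f g, coeFn_tensorVec f g',
    Lp.coeFn_add (tensorVec f g) (tensorVec f g'),
    quasiMeasurePreserving_inr.ae (Lp.coeFn_add g g')] with x h1 h2 h3 h4 h5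
  rw [h1, h4, Pi.add_apply, h2, h3, h5, Pi.add_apply, mul_add]

theorem tensorVec_smul_right (c : ℂ) (f : ModeSpace ι) (g : ModeSpace κ) :
    tensorVec f (c • g) = c • tensorVec f g := by
  apply Lp.ext
  filter_upwards [coeFn_tensorVec f (c • g), coeFn_tensorVec f g,
    Lp.coeFn_smul c (tensorVec f g),
    quasiMeasurePreserving_inr.ae (Lp.coeFn_smul c g)] with x h1 h2 h3 h4
  rw [h1, h3, Pi.smul_apply, h2, h4, Pi.smul_apply, smul_eq_mul, smul_eq_mul, mul_left_comm]

/-- Prepending a system of modes in the state vector `f`: the map `g ↦ f ⊗ g`. -/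
def tensorLeft (κ : Type) [Fintype κ] (f : ModeSpace ι) :
    ModeSpace κ →L[ℂ] ModeSpace (ι ⊕ κ) :=
  LinearMap.mkContinuous
    { toFun := fun g => tensorVec f g
      map_add' := tensorVec_add_right f
      map_smul' := fun c g => tensorVec_smul_right c f g }
    ‖f‖ fun g => (norm_tensorVec f g).le

@[simp] theorem tensorLeft_apply (f : ModeSpace ι) (g : ModeSpace κ) :
    tensorLeft κ f g = tensorVec f g := rfl

@[simp] theorem tensorRight_apply (f : ModeSpace ι) (g : ModeSpace κ) :
    tensorRight ι g f = tensorVec f g := rfl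

theorem coeFn_vacuum (ι : Type) [Fintype ι] :
    vacuum ι =ᵐ[volume] fun x : ι → ℝ =>
      ∏ j, (((Real.pi ^ (-(1 / 4) : ℝ) * Real.exp (-(x j) ^ 2 / 2) : ℝ)) : ℂ) :=
  MemLp.coeFn_toLp _

theorem tensorVec_vacuum : tensorVec (vacuum ι) (vacuum κ) = vacuum (ι ⊕ κ) := by
  apply Lp.ext
  filter_upwards [coeFn_tensorVec (vacuum ι) (vacuum κ), coeFn_vacuum (ι ⊕ κ),
    quasiMeasurePreserving_inl.ae (coeFn_vacuum ι),
    quasiMeasurePreserving_inr.ae (coeFn_vacuum κ)] with x h1 h2 h3 h4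
  rw [h1, h2, h3, h4, Fintype.prod_sum_type]

theorem norm_vacuum (ι : Type) [Fintype ι] : ‖vacuum ι‖ = 1 := by
  have h : ⟪vacuum ι, vacuum ι⟫_ℂ = 1 := by
    rw [L2.inner_def]
    have e : ∀ᵐ x : ι → ℝ, ⟪vacuum ι x, vacuum ι x⟫_ℂ =
        ((∏ j, ((√Real.pi)⁻¹ * Real.exp (-1 * (x j) ^ 2)) : ℝ) : ℂ) := by
      filter_upwards [coeFn_vacuum ι] with x hx
      rw [hx, inner_self_eq_norm_sq_to_K, ← RCLike.ofReal_pow, norm_prod, ← Finset.prod_pow]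
      refine congrArg _ (Finset.prod_congr rfl fun j _ => ?_)
      rw [Complex.norm_real, Real.norm_eq_abs, sq_abs, mul_pow, ← Real.exp_nat_mul,
        ← Real.rpow_natCast, ← Real.rpow_mul Real.pi_pos.le, Real.sqrt_eq_rpow,
        ← Real.rpow_neg Real.pi_pos.le]
      congr 2
      · norm_num
      · push_cast; ring
    rw [integral_congr_ae e, integral_complex_ofReal]
    have : ∫ x : ι → ℝ, ∏ j, ((√Real.pi)⁻¹ * Real.exp (-1 * (x j) ^ 2)) = 1 := by
      rw [volume_pi, integral_fintype_prod_eq_prod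
        (f := fun _ y => (√Real.pi)⁻¹ * Real.exp (-1 * y ^ 2))]
      rw [Finset.prod_eq_one]
      intro j _
      rw [integral_const_mul, integral_gaussian, div_one, inv_mul_cancel₀]
      exact (Real.sqrt_pos.2 Real.pi_pos).ne'
    rw [this, Complex.ofReal_one]
  rw [inner_self_eq_norm_sq_to_K, ← RCLike.ofReal_pow] at h
  have h2 : ‖vacuum ι‖ ^ 2 = 1 := Complex.ofReal_injective (by simpa using h)
  exact (pow_eq_one_iff_of_nonneg (norm_nonneg _) two_ne_zero).1 h2

end WeylOperators

/-! ### Injectivity of the Fourier transform on integrable functions -/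

section FourierInjective

open FourierTransform SchwartzMap
open scoped ContDiff

theorem ae_eq_zero_of_fourier_eq_zero {V : Type} [NormedAddCommGroup V] [InnerProductSpace ℝ V]
    [FiniteDimensional ℝ V] [MeasurableSpace V] [BorelSpace V] {f : V → ℂ} (hf : Integrable f)
    (h : ∀ w, 𝓕 f w = 0) : ∀ᵐ x, f x = 0 := by
  refine ae_eq_zero_of_integral_contDiff_smul_eq_zero hf.locallyIntegrable fun g hg hs => ?_
  have hs' : HasCompactSupport fun x => (g x : ℂ) := hs.comp_left (g := fun r : ℝ => (r : ℂ)) rfl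
  set G : 𝓢(V, ℂ) := hs'.toSchwartzMap (Complex.ofRealCLM.contDiff.comp hg) with hG
  have key := VectorFourier.integral_fourierIntegral_smul_eq_flip (μ := (volume : Measure V))
    (ν := (volume : Measure V)) (L := innerₗ V) Real.continuous_fourierChar continuous_inner hf
    (𝓕⁻ G).integrable
  have h1 : ∀ w, VectorFourier.fourierIntegral Real.fourierChar volume (innerₗ V) f w = 0 := h
  have h2 : VectorFourier.fourierIntegral Real.fourierChar volume (innerₗ V).flip
      ((𝓕⁻ G : 𝓢(V, ℂ)) : V → ℂ) = G := by
    have e : VectorFourier.fourierIntegral Real.fourierChar volume (innerₗ V).flip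
        ((𝓕⁻ G : 𝓢(V, ℂ)) : V → ℂ) =
        𝓕 ((𝓕⁻ G : 𝓢(V, ℂ)) : V → ℂ) := by
      rw [flip_innerₗ]; rfl
    rw [e, ← fourier_coe, fourier_fourierInv_eq]
  simp only [h1, zero_smul, integral_zero, h2] at key
  rw [key]
  refine integral_congr_ae (Filter.Eventually.of_forall fun x => ?_)
  change g x • f x = f x • (g x : ℂ)
  rw [Complex.real_smul, smul_eq_mul, mul_comm]

/-- An integrable function on `ℝ^ι` whose Fourier transform vanishes is zero. -/
theorem ae_eq_zero_of_integral_exp_eq_zero {ι : Type} [Fintype ι] {f : (ι → ℝ) → ℂ}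
    (hf : Integrable f)
    (h : ∀ b : ι → ℝ, ∫ x, Complex.exp (Complex.I * ((∑ j, b j * x j : ℝ) : ℂ)) * f x = 0) :
    ∀ᵐ x, f x = 0 := by
  have hp := PiLp.volume_preserving_ofLp ι
  have he := (EuclideanSpace.volume_preserving_symm_measurableEquiv_toLp ι)
  have h1 : ∀ᵐ v : EuclideanSpace ℝ ι, f v.ofLp = 0 := by
    refine ae_eq_zero_of_fourier_eq_zero (hp.integrable_comp_of_integrable hf) fun w => ?_
    rw [Real.fourier_eq]
    refine Eq.trans ?_ (h fun j => -(2 * Real.pi * w j))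
    refine Eq.trans ?_ (he.integral_comp' _)
    refine integral_congr_ae (Filter.Eventually.of_forall fun v => ?_)
    change Real.fourierChar (-⟪v, w⟫_ℝ) • f v.ofLp = Complex.exp (Complex.I *
      ((∑ j, -(2 * Real.pi * w j) * v j : ℝ) : ℂ)) * f v.ofLp
    rw [Circle.smul_def, Real.fourierChar_apply, smul_eq_mul, PiLp.inner_apply, mul_comm Complex.I]
    congr 4
    rw [← Finset.sum_neg_distrib, Finset.mul_sum]
    refine Finset.sum_congr rfl fun j _ => ?_
    simp only [RCLike.inner_apply, conj_trivial]
    ring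
  have h2 := (PiLp.volume_preserving_toLp ι).quasiMeasurePreserving.ae h1
  exact h2

end FourierInjective

section Totality

variable {ι κ : Type} [Fintype ι] [Fintype κ]

/-- The coherent states `D(z)|0⟩` are total: already those with purely imaginary `z` are, since
their inner products with `F` form the Fourier transform of `F` times a Gaussian. -/
theorem eq_zero_of_inner_weyl_vacuum {F : ModeSpace ι}
    (h : ∀ z, ⟪weyl z (vacuum ι), F⟫_ℂ = 0) : F = 0 := by
  have hi : Integrable fun x => ⟪vacuum ι x, F x⟫_ℂ := L2.integrable_inner _ _
  have h1 := ae_eq_zero_of_integral_exp_eq_zero hi fun b => by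
    refine Eq.trans ?_ (h fun j => Complex.I * ((-b j / √2 : ℝ) : ℂ))
    rw [L2.inner_def]
    refine integral_congr_ae ?_
    filter_upwards [coeFn_weyl (fun j => Complex.I * ((-b j / √2 : ℝ) : ℂ)) (vacuum ι)] with x hx
    rw [hx]
    simp only [RCLike.inner_apply, map_mul]
    have : conj (weylPhase (fun j => Complex.I * ((-b j / √2 : ℝ) : ℂ)) x) =
        Complex.exp (Complex.I * ((∑ j, b j * x j : ℝ) : ℂ)) := by
      unfold weylPhase
      rw [← Complex.exp_conj, map_mul, Complex.conj_I, Complex.conj_ofReal, neg_mul, ← mul_neg,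
        ← Complex.ofReal_neg, ← Finset.sum_neg_distrib]
      congr 4
      ext j
      have h2 : √(2 : ℝ) ≠ 0 := by positivity
      simp
      field_simp
    rw [this]
    simp
    ring
  apply Lp.ext
  filter_upwards [h1, coeFn_vacuum ι, Lp.coeFn_zero ℂ 2 (volume : Measure (ι → ℝ))] with x hx hv h0
  rw [h0]
  simp only [RCLike.inner_apply, mul_eq_zero, map_eq_zero] at hx
  refine hx.resolve_right ?_
  rw [hv]
  refine Finset.prod_ne_zero_iff.2 fun j _ => ?_
  rw [Complex.ofReal_ne_zero]
  have := Real.rpow_pos_of_pos Real.pi_pos (-(1 / 4))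
  positivity

theorem HilbertBasis.eq_zero_of_inner {H J : Type} [NormedAddCommGroup H] [InnerProductSpace ℂ H]
    (b : HilbertBasis J ℂ H) {x : H} (h : ∀ j, ⟪b j, x⟫_ℂ = 0) : x = 0 := by
  have := b.hasSum_repr x
  simp only [HilbertBasis.repr_apply_apply, h, zero_smul] at this
  exact this.unique hasSum_zero

/-- Products of basis vectors form an orthonormal basis of the joint system. -/
theorem exists_hilbertBasis_tensorVec {J J' : Type} (b : HilbertBasis J ℂ (ModeSpace ι))
    (e : HilbertBasis J' ℂ (ModeSpace κ)) :
    ∃ c : HilbertBasis (J × J') ℂ (ModeSpace (ι ⊕ κ)), ∀ p, c p = tensorVec (b p.1) (e p.2) := by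
  classical
  have ho : Orthonormal ℂ fun p : J × J' => tensorVec (b p.1) (e p.2) := by
    rw [orthonormal_iff_ite]
    intro p q
    rw [inner_tensorVec, orthonormal_iff_ite.1 b.orthonormal, orthonormal_iff_ite.1 e.orthonormal]
    by_cases h1 : p.1 = q.1 <;> by_cases h2 : p.2 = q.2 <;> simp [h1, h2, Prod.ext_iff]
  refine ⟨HilbertBasis.mkOfOrthogonalEqBot ho ?_, fun p => by rw [HilbertBasis.coe_mkOfOrthogonalEqBot]⟩
  rw [Submodule.eq_bot_iff]
  intro F hF
  have h1 : ∀ i j, ⟪tensorVec (b i) (e j), F⟫_ℂ = 0 := fun i j =>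
    (Submodule.mem_orthogonal _ _).1 hF _ (Submodule.subset_span ⟨(i, j), rfl⟩)
  have h2 : ∀ (f : ModeSpace ι) (j : J'), ⟪tensorVec f (e j), F⟫_ℂ = 0 := fun f j => by
    have : (tensorRight ι (e j)).adjoint F = 0 := b.eq_zero_of_inner fun i => by
      rw [ContinuousLinearMap.adjoint_inner_right]
      exact h1 i j
    rw [← tensorRight_apply, ← ContinuousLinearMap.adjoint_inner_right, this, inner_zero_right]
  have h3 : ∀ (f : ModeSpace ι) (g : ModeSpace κ), ⟪tensorVec f g, F⟫_ℂ = 0 := fun f g => by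
    have : (tensorLeft κ f).adjoint F = 0 := e.eq_zero_of_inner fun j => by
      rw [ContinuousLinearMap.adjoint_inner_right]
      exact h2 f j
    rw [← tensorLeft_apply, ← ContinuousLinearMap.adjoint_inner_right, this, inner_zero_right]
  refine eq_zero_of_inner_weyl_vacuum fun z => ?_
  rw [← tensorVec_vacuum, weyl_tensorVec]
  exact h3 _ _

end Totality

/-! ### Weyl operators separate trace-class operators -/

section Separation

variable {ι : Type} [Fintype ι]

theorem integral_norm_mul_norm_le {X : Type} [MeasurableSpace X] {μ : Measure X} {f g : X → ℂ}
    (hf : MemLp f 2 μ) (hg : MemLp g 2 μ) :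
    ∫ x, ‖f x * g x‖ ∂μ ≤ (eLpNorm f 2 μ).toReal * (eLpNorm g 2 μ).toReal := by
  have h := eLpNorm_smul_le_mul_eLpNorm (p := 2) (q := 2) (r := 1) hg.1 hf.1
  rw [← ENNReal.toReal_mul]
  have h1 : Integrable (fun x => f x * g x) μ := hf.integrable_mul hg
  rw [integral_norm_eq_lintegral_enorm h1.1, ← eLpNorm_one_eq_lintegral_enorm]
  exact ENNReal.toReal_mono (ENNReal.mul_ne_top hf.2.ne hg.2.ne) h

theorem integrable_tsum_of_summable_integral_norm {X J : Type} [MeasurableSpace X] {μ : Measure X}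
    [Countable J] {F : J → X → ℂ} (hF : ∀ k, Integrable (F k) μ)
    (hs : Summable fun k => ∫ x, ‖F k x‖ ∂μ) : Integrable (fun x => ∑' k, F k x) μ := by
  have hl : ∫⁻ x, ∑' k, ‖F k x‖ₑ ∂μ < ⊤ := by
    rw [lintegral_tsum fun k => (hF k).1.enorm]
    have : ∀ k, ∫⁻ x, ‖F k x‖ₑ ∂μ = ENNReal.ofReal (∫ x, ‖F k x‖ ∂μ) := fun k => by
      rw [ofReal_integral_norm_eq_lintegral_enorm (hF k)]
    simp only [this]
    exact hs.tsum_ofReal_lt_top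
  have hfin := ae_lt_top' (AEMeasurable.tsum fun k => (hF k).1.enorm) hl.ne
  have hsum : ∀ᵐ x ∂μ, Summable fun k => F k x := by
    filter_upwards [hfin] with x hx
    refine Summable.of_norm ?_
    have := ENNReal.summable_toReal hx.ne
    simpa using this
  refine ⟨?_, ?_⟩
  · refine aestronglyMeasurable_of_tendsto_ae (u := Filter.atTop)
      (f := fun (s : Finset J) x => ∑ k ∈ s, F k x) (fun s => ?_) ?_
    · exact (integrable_finsetSum s fun k _ => hF k).1
    · filter_upwards [hsum] with x hx
      exact hx.hasSum
  · refine lt_of_le_of_lt (lintegral_mono fun x => ?_) hl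
    exact enorm_tsum_le_tsum_enorm

/-- The formula for matrix elements of Weyl operators as Fourier integrals, with `√2 z = a + i b`;
the phase `exp(i a·b/2)` does not depend on the integration variable. -/
theorem integral_exp_mul_eq_inner_weyl (a b : ι → ℝ) (φ ψ : ModeSpace ι) :
    ∫ x, Complex.exp (Complex.I * ((∑ j, b j * x j : ℝ) : ℂ)) * (ψ x * conj (φ (x + a))) =
      Complex.exp (-(Complex.I * ((∑ j, b j * a j / 2 : ℝ) : ℂ))) *
        ⟪φ, weyl (fun j => (((a j / √2 : ℝ) : ℂ) + Complex.I * ((b j / √2 : ℝ) : ℂ))) ψ⟫_ℂ := by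
  have h2 : √(2 : ℝ) ≠ 0 := by positivity
  set z : ι → ℂ := fun j => (((a j / √2 : ℝ) : ℂ) + Complex.I * ((b j / √2 : ℝ) : ℂ)) with hz
  have hre : ∀ j, √2 * (z j).re = a j := fun j => by simp [hz]; field_simp
  have him : ∀ j, √2 * (z j).im = b j := fun j => by simp [hz]; field_simp
  have e1 : ⟪φ, weyl z ψ⟫_ℂ = ∫ y, weylPhase z y * ψ (y - a) * conj (φ y) := by
    rw [L2.inner_def]
    refine integral_congr_ae ?_
    filter_upwards [coeFn_weyl z ψ] with y hy
    rw [hy, RCLike.inner_apply]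
    simp only [hre]
    rfl
  rw [e1, ← integral_add_right_eq_self (fun y => weylPhase z y * ψ (y - a) * conj (φ y)) a,
    ← integral_const_mul]
  refine integral_congr_ae (Filter.Eventually.of_forall fun x => ?_)
  simp only [add_sub_cancel_right]
  have e2 : Complex.exp (Complex.I * ((∑ j, b j * x j : ℝ) : ℂ)) =
      Complex.exp (-(Complex.I * ((∑ j, b j * a j / 2 : ℝ) : ℂ))) * weylPhase z (x + a) := by
    rw [weylPhase, ← Complex.exp_add, ← mul_neg, ← mul_add, ← Complex.ofReal_neg,
      ← Complex.ofReal_add, ← Finset.sum_neg_distrib, ← Finset.sum_add_distrib]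
    congr 3
    refine Finset.sum_congr rfl fun j _ => ?_
    have e3 : (z j).re * (z j).im = a j * b j / 2 := by
      rw [← hre, ← him]
      linear_combination (-(z j).re * (z j).im / 2) * Real.sq_sqrt (zero_le_two (α := ℝ))
    rw [e3, him, Pi.add_apply]
    ring
  rw [e2]
  ring

/-- If all traces `∑ k, ⟪φ k, D(z) ψ k⟫` of the operator `∑ k, |ψ k⟩⟨φ k|` against Weyl operators
vanish, then so do its matrix elements. For fixed displacement `a` the traces are the Fourier
transform of the off-diagonal `x ↦ ∑ k, ψ k x * conj (φ k (x + a))` of the integral kernel. -/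
theorem tsum_inner_mul_inner_eq_zero {J : Type} [Countable J] {φ ψ : J → ModeSpace ι}
    (hs : Summable fun k => ‖ψ k‖ * ‖φ k‖)
    (h : ∀ z, ∑' k, ⟪φ k, weyl z (ψ k)⟫_ℂ = 0) (f g : ModeSpace ι) :
    ∑' k, ⟪f, ψ k⟫_ℂ * ⟪φ k, g⟫_ℂ = 0 := by
  have hstar : ∀ u : ModeSpace ι, MemLp (fun x => conj (u x)) 2 (volume : Measure (ι → ℝ)) :=
    fun u => (Lp.memLp u).star
  have hstarn : ∀ u : ModeSpace ι,
      (eLpNorm (fun x => conj (u x)) 2 (volume : Measure (ι → ℝ))).toReal = ‖u‖ := fun u => by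
    rw [Lp.norm_def]
    congr 1
    exact eLpNorm_congr_norm_ae (Filter.Eventually.of_forall fun x => by simp)
  -- the kernel vanishes almost everywhere on every translate of the diagonal
  have hdiag : ∀ a : ι → ℝ, ∀ᵐ x, ∑' k, ψ k x * conj (φ k (x + a)) = 0 := by
    intro a
    have ha := measurePreserving_add_right (volume : Measure (ι → ℝ)) a
    have hm : ∀ k, MemLp (fun x => conj (φ k (x + a))) 2 (volume : Measure (ι → ℝ)) := fun k =>
      (hstar (φ k)).comp_measurePreserving ha
    have hi : ∀ k, Integrable fun x => ψ k x * conj (φ k (x + a)) := fun k =>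
      (Lp.memLp (ψ k)).integrable_mul (hm k)
    have hn : ∀ k, ∫ x, ‖ψ k x * conj (φ k (x + a))‖ ≤ ‖ψ k‖ * ‖φ k‖ := fun k => by
      refine (integral_norm_mul_norm_le (Lp.memLp (ψ k)) (hm k)).trans_eq ?_
      rw [← hstarn (φ k), Lp.norm_def]
      congr 2
      exact eLpNorm_comp_measurePreserving (hstar (φ k)).1 ha
    have hsn : Summable fun k => ∫ x, ‖ψ k x * conj (φ k (x + a))‖ :=
      Summable.of_nonneg_of_le (fun k => integral_nonneg fun _ => norm_nonneg _) hn hs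
    refine ae_eq_zero_of_integral_exp_eq_zero
      (integrable_tsum_of_summable_integral_norm hi hsn) fun b => ?_
    have he : ∀ x : ι → ℝ, ‖Complex.exp (Complex.I * ((∑ j, b j * x j : ℝ) : ℂ))‖ = 1 :=
      fun x => by rw [mul_comm, Complex.norm_exp_ofReal_mul_I]
    have hie : ∀ k, Integrable fun x => Complex.exp (Complex.I * ((∑ j, b j * x j : ℝ) : ℂ)) *
        (ψ k x * conj (φ k (x + a))) := fun k => by
      refine (hi k).bdd_mul (c := 1) ?_ (Filter.Eventually.of_forall fun x => (he x).le)
      exact Continuous.aestronglyMeasurable (by fun_prop)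
    have hsum := hasSum_integral_of_summable_integral_norm hie
      (by simpa only [norm_mul, he, one_mul] using hsn)
    simp only [tsum_mul_left] at hsum
    rw [← hsum.tsum_eq]
    simp only [integral_exp_mul_eq_inner_weyl]
    rw [tsum_mul_left, h, mul_zero]
  have hF : ∀ k, Integrable (fun p : (ι → ℝ) × (ι → ℝ) =>
      (conj (f p.1) * ψ k p.1) * (conj (φ k p.2) * g p.2)) (volume.prod volume) := fun k =>
    ((hstar f).integrable_mul (Lp.memLp (ψ k))).mul_prod
      ((hstar (φ k)).integrable_mul (Lp.memLp g))
  have hFn : Summable fun k => ∫ p : (ι → ℝ) × (ι → ℝ),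
      ‖(conj (f p.1) * ψ k p.1) * (conj (φ k p.2) * g p.2)‖ ∂(volume.prod volume) := by
    refine Summable.of_nonneg_of_le (fun k => integral_nonneg fun _ => norm_nonneg _) (fun k => ?_)
      (hs.mul_left (‖f‖ * ‖g‖))
    simp only [norm_mul (_ * _) (_ * _)]
    rw [integral_prod_mul (fun x => ‖conj (f x) * ψ k x‖) (fun y => ‖conj (φ k y) * g y‖)]
    have h1 := integral_norm_mul_norm_le (hstar f) (Lp.memLp (ψ k))
    have h2 := integral_norm_mul_norm_le (hstar (φ k)) (Lp.memLp g)
    rw [hstarn, ← Lp.norm_def] at h1 h2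
    calc _ ≤ (‖f‖ * ‖ψ k‖) * (‖φ k‖ * ‖g‖) :=
          mul_le_mul h1 h2 (integral_nonneg fun _ => norm_nonneg _) (by positivity)
      _ = _ := by ring
  have hsum := (hasSum_integral_of_summable_integral_norm hF hFn).tsum_eq
  have hL : ∀ k, ∫ p : (ι → ℝ) × (ι → ℝ), (conj (f p.1) * ψ k p.1) * (conj (φ k p.2) * g p.2)
      ∂(volume.prod volume) = ⟪f, ψ k⟫_ℂ * ⟪φ k, g⟫_ℂ := fun k => by
    rw [integral_prod_mul (fun x => conj (f x) * ψ k x) (fun y => conj (φ k y) * g y),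
      L2.inner_def, L2.inner_def]
    simp only [RCLike.inner_apply, mul_comm]
  simp only [hL] at hsum
  -- integrate the kernel along the translates of the diagonal
  rw [hsum, ← (measurePreserving_prod_add volume volume).integral_comp
    (MeasurableEquiv.shearAddRight (ι → ℝ)).measurableEmbedding]
  by_cases hint : Integrable (fun p : (ι → ℝ) × (ι → ℝ) => ∑' k,
      (conj (f p.1) * ψ k p.1) * (conj (φ k (p.1 + p.2)) * g (p.1 + p.2))) (volume.prod volume)
  · rw [integral_prod_symm _ hint]
    refine integral_eq_zero_of_ae (Filter.Eventually.of_forall fun a => ?_)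
    refine integral_eq_zero_of_ae ?_
    filter_upwards [hdiag a] with x hx
    have : ∀ k, (conj (f x) * ψ k x) * (conj (φ k (x + a)) * g (x + a)) =
        conj (f x) * g (x + a) * (ψ k x * conj (φ k (x + a))) := fun k => by ring
    simp only [this, tsum_mul_left, hx, mul_zero, Pi.zero_apply]
  -- a non-integrable function has integral zero by convention, so integrability is not needed
  · exact integral_undef hint

theorem HilbertBasis.countable {H J : Type} [NormedAddCommGroup H] [InnerProductSpace ℂ H]
    [TopologicalSpace.SeparableSpace H] (b : HilbertBasis J ℂ H) : Countable J := by
  refine Pairwise.countable_of_isOpen_disjoint (s := fun j => Metric.ball (b j) (1 / 2))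
    (fun i j hij => ?_) (fun j => Metric.isOpen_ball) fun j => Metric.nonempty_ball.2 (by norm_num)
  refine Metric.ball_disjoint_ball ?_
  rw [dist_eq_norm]
  have h : ‖b i - b j‖ ^ 2 = 2 := by
    rw [@norm_sub_sq ℂ, b.orthonormal.2 hij, b.orthonormal.1, b.orthonormal.1]
    norm_num
  nlinarith [norm_nonneg (b i - b j)]

/-- The index set of `modeBasis`. -/
def ModeIndex (ι : Type) [Fintype ι] : Type :=
  ((exists_hilbertBasis ℂ (ModeSpace ι)).choose : Set (ModeSpace ι))

/-- A chosen orthonormal basis of the mode space. -/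
def modeBasis (ι : Type) [Fintype ι] : HilbertBasis (ModeIndex ι) ℂ (ModeSpace ι) :=
  (exists_hilbertBasis ℂ (ModeSpace ι)).choose_spec.choose

/-- The characteristic function `z ↦ Tr (ρ D(z))` of a state. The trace is computed in a chosen
orthonormal basis; it does not depend on the choice by `exists_hasSum_trace`. -/
def DensityOperator.charFn (ρ : DensityOperator (ModeSpace ι)) (z : ι → ℂ) : ℂ :=
  ∑' j, ⟪modeBasis ι j, ρ.op (weyl z (modeBasis ι j))⟫_ℂ

/-- States with the same characteristic function are equal. -/
theorem DensityOperator.ext_charFn {ρ σ : DensityOperator (ModeSpace ι)}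
    (h : ∀ z, ρ.charFn z = σ.charFn z) : ρ = σ := by
  unfold charFn at h
  generalize modeBasis ι = b at h
  generalize ModeIndex ι = J at b
  have : Fact ((2 : ENNReal) ≠ ⊤) := ⟨ENNReal.ofNat_ne_top⟩
  have : Countable J := b.countable
  obtain ⟨X, hX, hX1⟩ := ρ.exists_factor
  obtain ⟨Y, hY, hY1⟩ := σ.exists_factor
  -- the operator `ρ - σ` as a series of rank-one operators indexed by `J ⊕ J`
  let ψ : J ⊕ J → ModeSpace ι := Sum.elim (fun k => X (b k)) fun k => Y (b k)
  let φ : J ⊕ J → ModeSpace ι := Sum.elim (fun k => X (b k)) fun k => -Y (b k)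
  have hs : Summable fun k => ‖ψ k‖ * ‖φ k‖ := by
    refine (HasSum.sum (f := fun k => ‖ψ k‖ * ‖φ k‖) (a := 1) (b := 1) ?_ ?_).summable
    · simpa [ψ, φ, Function.comp_def, ← sq] using hX1 J b
    · simpa [ψ, φ, Function.comp_def, ← sq] using hY1 J b
  have key : ∀ (u : ℂ) (A B : J → ℂ), HasSum A u → HasSum B u →
      ∑' k : J ⊕ J, Sum.elim A (fun k => -B k) k = 0 := fun u A B hA hB => by
    have := HasSum.sum (f := Sum.elim A fun k => -B k) hA hB.neg
    simpa using this.tsum_eq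
  have hW : ∀ z, ∑' k, ⟪φ k, weyl z (ψ k)⟫_ℂ = 0 := fun z => by
    obtain ⟨t, ht1, ht2⟩ := exists_hasSum_trace hX1 (weylIsometry z).toContinuousLinearMap
    obtain ⟨t', ht1', ht2'⟩ := exists_hasSum_trace hY1 (weylIsometry z).toContinuousLinearMap
    simp only [LinearIsometry.coe_toContinuousLinearMap, weylIsometry_apply, ← hX, ← hY]
      at ht1 ht2 ht1' ht2'
    have htt : t = t' := by rw [← (ht1 J b).tsum_eq, ← (ht1' J b).tsum_eq, h]
    subst htt
    refine Eq.trans (tsum_congr ?_) (key t _ _ (ht2 J b) (ht2' J b))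
    rintro (k | k) <;> simp [φ, ψ]
  apply DensityOperator.ext_op
  ext1 g
  refine ext_inner_left ℂ fun f => ?_
  have h0 := tsum_inner_mul_inner_eq_zero hs hW f g
  have hA : ∀ Z : ModeSpace ι →L[ℂ] ModeSpace ι,
      HasSum (fun k => ⟪f, Z (b k)⟫_ℂ * ⟪Z (b k), g⟫_ℂ) ⟪f, (Z ∘L Z.adjoint) g⟫_ℂ := fun Z => by
    have := b.hasSum_inner_mul_inner (Z.adjoint f) (Z.adjoint g)
    rw [ContinuousLinearMap.adjoint_inner_left] at this
    simp only [ContinuousLinearMap.adjoint_inner_left,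
      ContinuousLinearMap.adjoint_inner_right] at this
    exact this
  have h1 := HasSum.sum (f := fun k => ⟪f, ψ k⟫_ℂ * ⟪φ k, g⟫_ℂ) (hA X)
    (by simpa [ψ, φ, Function.comp_def] using (hA Y).neg)
  rw [h1.tsum_eq] at h0
  rw [hX, hY]
  exact add_neg_eq_zero.1 h0

end Separation

/-! ### Partial traces and Gaussian dilations -/

section Dilations

variable {ι κ φ : Type} [Fintype ι] [Fintype κ] [Fintype φ]

/-- The partial trace over the modes `φ` of the state `Y Y†` exists. It is the norm-convergent
series `∑ j, R_j† Y Y† R_j` with `R_j f = f ⊗ e_j`. -/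
theorem exists_partialTrace {K : Type} [NormedAddCommGroup K] [InnerProductSpace ℂ K]
    [CompleteSpace K] {Y : K →L[ℂ] ModeSpace (κ ⊕ φ)} (hY : HasHSNormSq Y 1) :
    ∃ τ : DensityOperator (ModeSpace κ), ∀ (J : Type) (e : HilbertBasis J ℂ (ModeSpace φ))
      (x y : ModeSpace κ),
      HasSum (fun j => ⟪tensorVec x (e j), (Y ∘L Y.adjoint) (tensorVec y (e j))⟫_ℂ)
        ⟪x, τ.op y⟫_ℂ := by
  obtain ⟨J, e, -⟩ := exists_hilbertBasis ℂ (ModeSpace φ)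
  obtain ⟨J', b, -⟩ := exists_hilbertBasis ℂ (ModeSpace κ)
  -- double series of the trace in a product basis
  have hdouble : ∀ (J' : Type) (b : HilbertBasis J' ℂ (ModeSpace κ)),
      HasSum (fun p : J' × J => ‖Y.adjoint (tensorVec (b p.1) (e p.2))‖ ^ 2) 1 := fun J' b => by
    obtain ⟨c, hc⟩ := exists_hilbertBasis_tensorVec b e
    simpa only [hc] using hY.adjoint _ c
  let S : J → ModeSpace κ →L[ℂ] K := fun j => Y.adjoint ∘L tensorRight κ (e j)
  have hSnorm : Summable fun j => ‖S j‖ ^ 2 := by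
    have h1 : HasSum (fun p : J × J' => ‖S p.1 (b p.2)‖ ^ 2) 1 :=
      (Equiv.prodComm J J').hasSum_iff.2 (hdouble _ b)
    have h2 := (summable_prod_of_nonneg (fun _ => by positivity)).1 h1.summable
    exact Summable.of_nonneg_of_le (fun _ => by positivity)
      (fun j => norm_sq_le_of_hasSum b (h2.1 j).hasSum) h2.2
  have hsum : Summable fun j => (S j).adjoint ∘L S j := by
    refine Summable.of_norm_bounded hSnorm fun j => ?_
    refine (ContinuousLinearMap.opNorm_comp_le _ _).trans_eq ?_
    rw [LinearIsometryEquiv.norm_map, sq]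
  obtain ⟨T, hT⟩ := hsum
  have hinner : ∀ x y, HasSum (fun j => ⟪S j x, S j y⟫_ℂ) ⟪x, T y⟫_ℂ := fun x y => by
    have h1 := (hT.mapL (ContinuousLinearMap.apply ℂ (ModeSpace κ) y)).mapL (innerSL ℂ x)
    simpa [ContinuousLinearMap.adjoint_inner_right] using h1
  have hnorm : ∀ x, HasSum (fun j => ((‖S j x‖ ^ 2 : ℝ) : ℂ)) ⟪x, T x⟫_ℂ := fun x => by
    have h1 := hinner x x
    simp only [inner_self_eq_norm_sq_to_K] at h1
    simpa using h1
  have hpos : T.IsPositive := by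
    rw [ContinuousLinearMap.isPositive_iff_complex]
    intro x
    have h1 := (hnorm x).mapL Complex.conjCLE.toContinuousLinearMap
    have h2 : ⟪T x, x⟫_ℂ = ⟪x, T x⟫_ℂ := by
      rw [← inner_conj_symm]
      exact HasSum.unique (by simpa using h1) (hnorm x)
    have h3 := (hnorm x).mapL Complex.reCLM
    simp only [Complex.reCLM_apply, Complex.ofReal_re] at h3
    rw [h2]
    refine ⟨?_, h3.nonneg fun j => by positivity⟩
    exact (Complex.hasSum_ofReal.2 h3).unique (hnorm x)
  refine ⟨⟨T, hpos, fun J₁ b₁ => ?_⟩, fun J₁ e₁ x y => ?_⟩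
  · have h1 : HasSum (fun p : J₁ × J => ((‖S p.2 (b₁ p.1)‖ ^ 2 : ℝ) : ℂ)) 1 := by
      simpa [S] using Complex.hasSum_ofReal.2 (hdouble _ b₁)
    exact HasSum.prod_fiberwise (g := fun i => ⟪b₁ i, T (b₁ i)⟫_ℂ) h1 fun i => hnorm (b₁ i)
  · -- the trace pairing of `Y† (x ⊗ ·)` and `Y† (y ⊗ ·)` does not depend on the basis `e`
    obtain ⟨c, hc⟩ := hY.adjoint.exists_precomp (tensorLeft φ x)
    obtain ⟨d, hd⟩ := hY.adjoint.exists_precomp (tensorLeft φ y)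
    obtain ⟨t, ht, -⟩ := exists_hasSum_inner hc hd
    have h1 : t = ⟪x, T y⟫_ℂ := (ht J e).unique (hinner x y)
    have h2 := ht J₁ e₁
    rw [h1] at h2
    simpa [ContinuousLinearMap.adjoint_inner_left] using h2

theorem exists_hasDilation {W : ModeSpace ι →L[ℂ] ModeSpace (κ ⊕ φ)} (hW : ∀ f, ‖W f‖ = ‖f‖) :
    ∃ N : StateMap ι κ, HasDilation N W := by
  have h : ∀ ρ : DensityOperator (ModeSpace ι), ∃ τ : DensityOperator (ModeSpace κ),
      ∀ (J : Type) (e : HilbertBasis J ℂ (ModeSpace φ)) (x y : ModeSpace κ),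
        HasSum (fun j => ⟪tensorVec x (e j), (W ∘L ρ.op ∘L W.adjoint) (tensorVec y (e j))⟫_ℂ)
          ⟪x, τ.op y⟫_ℂ := fun ρ => by
    obtain ⟨X, hX, hX1⟩ := ρ.exists_factor
    obtain ⟨τ, hτ⟩ := exists_partialTrace (hX1.isometry_comp hW)
    refine ⟨τ, fun J e x y => ?_⟩
    have := hτ J e x y
    rwa [ContinuousLinearMap.adjoint_comp, ContinuousLinearMap.comp_assoc,
      ← ContinuousLinearMap.comp_assoc X, ← hX] at this
  choose N hN using h
  exact ⟨N, hN⟩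

/-- The Heisenberg picture of a dilation: if the compression `W† (D(z) ⊗ 1) W` of a Weyl operator
is `c D(z')`, then `Tr (N(ρ) D(z)) = c Tr (ρ D(z'))`. -/
theorem HasDilation.charFn_eq {N : StateMap ι κ} {W : ModeSpace ι →L[ℂ] ModeSpace (κ ⊕ φ)}
    (hN : HasDilation N W) (ρ : DensityOperator (ModeSpace ι)) {z : κ → ℂ} {z' : ι → ℂ} {c : ℂ}
    (hW : ∀ f g, ⟪W f, weyl (Sum.elim z 0) (W g)⟫_ℂ = c * ⟪f, weyl z' g⟫_ℂ) :
    (N ρ).charFn z = c * ρ.charFn z' := by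
  obtain ⟨X, hX, hX1⟩ := ρ.exists_factor
  obtain ⟨d, hd⟩ := hX1.exists_comp W
  obtain ⟨t, ht1, ht2⟩ := exists_hasSum_trace hd
    (weylIsometry (Sum.elim z (0 : φ → ℂ))).toContinuousLinearMap
  obtain ⟨t', ht1', ht2'⟩ := exists_hasSum_trace hX1 (weylIsometry z').toContinuousLinearMap
  simp only [LinearIsometry.coe_toContinuousLinearMap, weylIsometry_apply] at ht1 ht2 ht1' ht2'
  have htt : t = c * t' := by
    refine (ht2 _ (modeBasis ι)).unique ?_
    have h2 := (ht2' _ (modeBasis ι)).mul_left c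
    simp only [← hW] at h2
    exact h2
  unfold DensityOperator.charFn
  rw [hX, (ht1' _ (modeBasis ι)).tsum_eq, ← htt]
  obtain ⟨e, he⟩ := exists_hilbertBasis_tensorVec (modeBasis κ) (modeBasis φ)
  refine (HasSum.prod_fiberwise
    (g := fun i => ⟪modeBasis κ i, (N ρ).op (weyl z (modeBasis κ i))⟫_ℂ) (ht1 _ e)
    fun i => ?_).tsum_eq
  have h3 := hN ρ _ (modeBasis φ) (modeBasis κ i) (weyl z (modeBasis κ i))
  have h4 : ∀ j, tensorVec (weyl z (modeBasis κ i)) (modeBasis φ j) =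
      weyl (Sum.elim z (0 : φ → ℂ)) (e (i, j)) := fun j => by
    rw [he, weyl_tensorVec]
    congr 1
    exact (weyl_zero _).symm
  simp only [h4] at h3
  rw [ContinuousLinearMap.adjoint_comp, ContinuousLinearMap.comp_assoc,
      ← ContinuousLinearMap.comp_assoc X, ← hX]
  simpa only [he] using h3

/-- The characteristic function of the output of a Gaussian dilation with environment `ε` in
vacuum: it is the characteristic function of the input at the transformed argument, times the
vacuum characteristic function of the environment. Both depend only on the rows of the Bogoliubov
transform that belong to the modes that are kept. -/
theorem HasDilation.charFn_of_vacuum {ε : Type} [Fintype ε] {N : StateMap ι κ}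
    {U : ModeSpace (ι ⊕ ε) ≃ₗᵢ[ℂ] ModeSpace (κ ⊕ φ)} {P Q : Matrix (κ ⊕ φ) (ι ⊕ ε) ℂ}
    (hU : ImplementsBogoliubov U P Q)
    (hN : HasDilation N
      (U.toLinearIsometry.toContinuousLinearMap ∘L tensorRight ι (vacuum ε)))
    (ρ : DensityOperator (ModeSpace ι)) (z : κ → ℂ) :
    (N ρ).charFn z =
      ⟪vacuum ε, weyl (fun j => ∑ i, (z i * conj (P (Sum.inl i) (Sum.inr j)) -
        conj (z i) * Q (Sum.inl i) (Sum.inr j))) (vacuum ε)⟫_ℂ *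
      ρ.charFn (fun j => ∑ i, (z i * conj (P (Sum.inl i) (Sum.inl j)) -
        conj (z i) * Q (Sum.inl i) (Sum.inl j))) := by
  refine hN.charFn_eq ρ fun f g => ?_
  change ⟪U (tensorVec f (vacuum ε)), weyl _ (U (tensorVec g (vacuum ε)))⟫_ℂ = _
  rw [hU, LinearIsometryEquiv.inner_map_map, weyl_tensorVec, inner_tensorVec]
  simp [mul_comm]

/-- The characteristic function of the output of a Gaussian dilation without environment. -/
theorem HasDilation.charFn_of_unitary {N : StateMap ι κ}
    {U : ModeSpace ι ≃ₗᵢ[ℂ] ModeSpace (κ ⊕ φ)} {P Q : Matrix (κ ⊕ φ) ι ℂ}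
    (hU : ImplementsBogoliubov U P Q)
    (hN : HasDilation N U.toLinearIsometry.toContinuousLinearMap)
    (ρ : DensityOperator (ModeSpace ι)) (z : κ → ℂ) :
    (N ρ).charFn z = ρ.charFn (fun j => ∑ i, (z i * conj (P (Sum.inl i) j) -
        conj (z i) * Q (Sum.inl i) j)) := by
  rw [← one_mul (ρ.charFn _)]
  refine hN.charFn_eq ρ fun f g => ?_
  change ⟪U f, weyl _ (U g)⟫_ℂ = _
  rw [hU, LinearIsometryEquiv.inner_map_map]
  simp

end Dilations

/-! ### Unitaries implementing linear canonical transformations -/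

section Unitaries

open FourierTransform SchwartzMap

variable {ι κ : Type} [Fintype ι] [Fintype κ]

/-- A linear change of position coordinates `y = A x`: the unitary `f ↦ c · f (A⁻¹ y)` transforms
positions with `A` and momenta with the contragredient matrix `B = (A⁻¹)ᵀ`. -/
theorem exists_unitary_linear [DecidableEq ι] [DecidableEq κ] {A B : Matrix κ ι ℝ}
    (hBA : B.transpose * A = 1) (hAB : A * B.transpose = 1) :
    ∃ U : ModeSpace ι ≃ₗᵢ[ℂ] ModeSpace κ, ∀ (z : κ → ℂ) (f : ModeSpace ι),
      weyl z (U f) = U (weyl (fun j => ∑ i,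
        (((z i).re * B i j : ℝ) + Complex.I * ((z i).im * A i j : ℝ))) f) := by
  have hl : ∀ y, A.mulVec (B.transpose.mulVec y) = y := fun y => by
    rw [Matrix.mulVec_mulVec, hAB, Matrix.one_mulVec]
  have hr : ∀ x, B.transpose.mulVec (A.mulVec x) = x := fun x => by
    rw [Matrix.mulVec_mulVec, hBA, Matrix.one_mulVec]
  let L : (κ → ℝ) ≃L[ℝ] (ι → ℝ) := LinearEquiv.toContinuousLinearEquiv
    { B.transpose.mulVecLin with invFun := A.mulVec, left_inv := hl, right_inv := hr }
  have hLa : ∀ y, L y = B.transpose.mulVec y := fun _ => rfl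
  -- `L` scales the volume by a constant `c`, compensated by the constant weight `c ^ (-1/2)`
  obtain ⟨c, hc, hmap⟩ : ∃ c : NNReal, c ≠ 0 ∧
      Measure.map L (volume : Measure (κ → ℝ)) = c • (volume : Measure (ι → ℝ)) :=
    ⟨_, (Measure.addHaarScalarFactor_pos_of_isAddHaarMeasure _ _).ne',
      Measure.isAddLeftInvariant_eq_smul _ _⟩
  have hmap' : Measure.map L.symm (volume : Measure (ι → ℝ)) =
      c⁻¹ • (volume : Measure (κ → ℝ)) := by
    have h1 : Measure.map L.symm (c • (volume : Measure (ι → ℝ))) =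
        (volume : Measure (κ → ℝ)) := by
      rw [← hmap, Measure.map_map L.symm.continuous.measurable L.continuous.measurable]
      simp
    rw [Measure.map_smul] at h1
    rw [← h1, smul_smul, inv_mul_cancel₀ hc, one_smul]
  set k : NNReal := NNReal.sqrt c⁻¹ with hk
  have hk2 : k ^ 2 = c⁻¹ := NNReal.sq_sqrt _
  have hk0 : k ≠ 0 := by
    rw [hk, Ne, NNReal.sqrt_eq_zero]
    exact inv_ne_zero hc
  have hw : IsometricWeight (volume : Measure (ι → ℝ)) (volume : Measure (κ → ℝ)) L
      (fun _ => ((k : ℝ) : ℂ)) :=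
    ⟨L.continuous.measurable, measurable_const, k, hk0, fun y => by simp, by
      rw [hk2, inv_inv, hmap]⟩
  have hw' : IsometricWeight (volume : Measure (κ → ℝ)) (volume : Measure (ι → ℝ)) L.symm
      (fun _ => (((k⁻¹ : NNReal) : ℝ) : ℂ)) :=
    ⟨L.symm.continuous.measurable, measurable_const, k⁻¹, inv_ne_zero hk0, fun y => by simp, by
      rw [inv_pow, hk2, inv_inv, hmap']⟩
  have hkk : ∀ y : κ → ℝ, ((k : ℝ) : ℂ) * (((k⁻¹ : NNReal) : ℝ) : ℂ) = 1 := fun y => by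
    rw [← Complex.ofReal_mul, ← NNReal.coe_mul, mul_inv_cancel₀ hk0]
    simp
  have hLL : ∀ y, L.symm (L y) = y := L.symm_apply_apply
  refine ⟨hw.toUnitary hw' hLL hkk, fun z f => ?_⟩
  set U := hw.toUnitary hw' hLL hkk
  set z' : ι → ℂ := fun j => ∑ i,
    (((z i).re * B i j : ℝ) + Complex.I * ((z i).im * A i j : ℝ)) with hz'
  have hre : (fun j => (z' j).re) = B.transpose.mulVec fun i => (z i).re := by
    ext j
    simp [hz', Matrix.mulVec, dotProduct, mul_comm]
  have him : (fun j => (z' j).im) = Matrix.vecMul (fun i => (z i).im) A := by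
    ext j
    simp [hz', Matrix.vecMul, dotProduct]
  apply Lp.ext
  filter_upwards [coeFn_weyl z (U f), hw.coeFn_toUnitary hw' hLL hkk (weyl z' f),
    hw.quasiMeasurePreserving.ae (coeFn_weyl z' f),
    (isometricWeight_weyl z).quasiMeasurePreserving.ae
      (hw.coeFn_toUnitary hw' hLL hkk f)] with y h1 h2 h3 h4
  rw [h1, h4]
  refine Eq.trans ?_ h2.symm
  rw [h3]
  have hdot : ∀ q : κ → ℝ, (fun j => (z' j).im) ⬝ᵥ L q = (fun i => (z i).im) ⬝ᵥ q := fun q => by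
    rw [him, hLa, ← Matrix.dotProduct_mulVec, hl]
  have hphase : weylPhase z y = weylPhase z' (L y) := by
    have e : ∀ (α : Type) [Fintype α] (u : α → ℂ) (x : α → ℝ),
        ∑ j, (√2 * (u j).im * x j - (u j).re * (u j).im) =
          √2 * ((fun j => (u j).im) ⬝ᵥ x) - (fun j => (u j).im) ⬝ᵥ (fun j => (u j).re) := by
      intro α _ u x
      simp only [dotProduct, Finset.sum_sub_distrib, Finset.mul_sum]
      congr 1 <;> exact Finset.sum_congr rfl fun j _ => by ring
    unfold weylPhase
    rw [e, e, hdot, hre, ← hLa, hdot]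
  have harg : L (fun j => y j - √2 * (z j).re) = fun j => L y j - √2 * (z' j).re := by
    have e1 : (fun j => y j - √2 * (z j).re) = y - √2 • fun j => (z j).re := rfl
    rw [e1, map_sub, map_smul, hLa (fun j => (z j).re), ← hre]
    rfl
  rw [hphase, harg]
  ring

/-- The unitary multiplication operator `exp (i ∑ t_j x_j² / 2)`, a shear of the momenta. -/
theorem exists_unitary_chirp (t : ι → ℝ) :
    ∃ U : ModeSpace ι ≃ₗᵢ[ℂ] ModeSpace ι, ∀ (z : ι → ℂ) (f : ModeSpace ι),
      weyl z (U f) = U (weyl (fun j =>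
        ((z j).re : ℂ) + Complex.I * (((z j).im - t j * (z j).re : ℝ) : ℂ)) f) := by
  have hw : ∀ t : ι → ℝ, IsometricWeight (volume : Measure (ι → ℝ)) volume id
      (fun x => Complex.exp (Complex.I * ((∑ j, t j * x j ^ 2 / 2 : ℝ) : ℂ))) := fun t => by
    refine ⟨measurable_id, by fun_prop, 1, one_ne_zero, fun y => ?_, by simp⟩
    rw [mul_comm, Complex.norm_exp_ofReal_mul_I, NNReal.coe_one]
  have hinv : ∀ y : ι → ℝ, Complex.exp (Complex.I * ((∑ j, t j * y j ^ 2 / 2 : ℝ) : ℂ)) *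
      Complex.exp (Complex.I * ((∑ j, (-t) j * (id y) j ^ 2 / 2 : ℝ) : ℂ)) = 1 := fun y => by
    rw [← Complex.exp_add, ← mul_add, ← Complex.ofReal_add, ← Finset.sum_add_distrib]
    simp [neg_div]
  refine ⟨(hw t).toUnitary (hw (-t)) (fun _ => rfl) hinv, fun z f => ?_⟩
  set U := (hw t).toUnitary (hw (-t)) (fun _ => rfl) hinv
  set z' : ι → ℂ := fun j =>
    ((z j).re : ℂ) + Complex.I * (((z j).im - t j * (z j).re : ℝ) : ℂ) with hz'
  have hre : ∀ j, (z' j).re = (z j).re := fun j => by simp [hz']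
  have him : ∀ j, (z' j).im = (z j).im - t j * (z j).re := fun j => by simp [hz']
  apply Lp.ext
  filter_upwards [coeFn_weyl z (U f), (hw t).coeFn_toUnitary (hw (-t)) (fun _ => rfl) hinv
    (weyl z' f), coeFn_weyl z' f, (isometricWeight_weyl z).quasiMeasurePreserving.ae
      ((hw t).coeFn_toUnitary (hw (-t)) (fun _ => rfl) hinv f)] with x h1 h2 h3 h4
  rw [h1, h4]
  refine Eq.trans ?_ h2.symm
  simp only [id]
  rw [h3]
  simp only [hre]
  rw [← mul_assoc, ← mul_assoc]
  congr 1
  unfold weylPhase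
  rw [← Complex.exp_add, ← Complex.exp_add, ← mul_add, ← mul_add, ← Complex.ofReal_add,
    ← Complex.ofReal_add, ← Finset.sum_add_distrib, ← Finset.sum_add_distrib]
  congr 3
  refine Finset.sum_congr rfl fun j _ => ?_
  rw [hre, him]
  linear_combination (t j * (z j).re ^ 2 / 2) * Real.sq_sqrt (zero_le_two (α := ℝ))

/-! ### Translations and modulations under the Fourier transform -/

section Fourier

variable {V : Type} [NormedAddCommGroup V] [InnerProductSpace ℝ V] [FiniteDimensional ℝ V]
  [MeasurableSpace V] [BorelSpace V]

theorem isometricWeight_translation (a : V) :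
    IsometricWeight (volume : Measure V) volume (fun v => v - a) (fun _ => 1) :=
  ⟨by fun_prop, measurable_const, 1, one_ne_zero, fun _ => by simp, by
    rw [(measurePreserving_sub_right volume a).map_eq]; simp⟩

theorem isometricWeight_modulation (b : V) :
    IsometricWeight (volume : Measure V) volume id
      (fun v => Complex.exp (Complex.I * (⟪b, v⟫_ℝ : ℂ))) :=
  ⟨measurable_id, by fun_prop, 1, one_ne_zero, fun y => by
    rw [mul_comm, Complex.norm_exp_ofReal_mul_I, NNReal.coe_one], by simp⟩

/-- Translation by `a` on `L²`. -/
def translation (a : V) : Lp ℂ 2 (volume : Measure V) →ₗᵢ[ℂ] Lp ℂ 2 (volume : Measure V) :=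
  (isometricWeight_translation a).toIsometry

/-- Multiplication by the character `exp (i ⟪b, ·⟫)` on `L²`. -/
def modulation (b : V) : Lp ℂ 2 (volume : Measure V) →ₗᵢ[ℂ] Lp ℂ 2 (volume : Measure V) :=
  (isometricWeight_modulation b).toIsometry

theorem coeFn_translation (a : V) (f : Lp ℂ 2 (volume : Measure V)) :
    translation a f =ᵐ[volume] fun v => f (v - a) := by
  filter_upwards [(isometricWeight_translation a).coeFn_toIsometry f] with v h
  exact h.trans (one_mul _)

theorem coeFn_modulation (b : V) (f : Lp ℂ 2 (volume : Measure V)) :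
    modulation b f =ᵐ[volume] fun v => Complex.exp (Complex.I * (⟪b, v⟫_ℝ : ℂ)) * f v :=
  (isometricWeight_modulation b).coeFn_toIsometry f

theorem translation_toLp (a : V) (g : 𝓢(V, ℂ)) :
    translation a (g.toLp 2) = (g.compSubConstCLM ℂ a).toLp 2 := by
  apply Lp.ext
  filter_upwards [coeFn_translation a (g.toLp 2), (g.compSubConstCLM ℂ a).coeFn_toLp 2,
    (isometricWeight_translation a).quasiMeasurePreserving.ae (g.coeFn_toLp 2 volume)] with v h1 h2 h3
  rw [h1, h2, h3, compSubConstCLM_apply]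

/-- The Fourier transform turns translations into modulations. -/
theorem fourier_translation (a : V) (f : Lp ℂ 2 (volume : Measure V)) :
    𝓕 (translation a f) = modulation (-(2 * Real.pi) • a) (𝓕 f) := by
  refine DenseRange.induction_on
    (SchwartzMap.denseRange_toLpCLM (p := 2) ENNReal.ofNat_ne_top) f
    (isClosed_eq ?_ ?_) fun g => ?_
  · exact (Lp.fourierTransformₗᵢ V ℂ).continuous.comp (translation a).continuous
  · exact (modulation _).continuous.comp (Lp.fourierTransformₗᵢ V ℂ).continuous
  · rw [toLpCLM_apply, translation_toLp, toLp_fourier_eq, toLp_fourier_eq]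
    apply Lp.ext
    filter_upwards [coeFn_modulation (-(2 * Real.pi) • a) ((𝓕 g).toLp 2), (𝓕 g).coeFn_toLp 2,
      (𝓕 (g.compSubConstCLM ℂ a)).coeFn_toLp 2] with w h1 h2 h3
    rw [h1, h2, h3, fourier_coe, fourier_coe, Real.fourier_eq, Real.fourier_eq,
      ← integral_const_mul, ← integral_add_right_eq_self _ a]
    refine integral_congr_ae (Filter.Eventually.of_forall fun v => ?_)
    simp only [compSubConstCLM_apply, add_sub_cancel_right, Circle.smul_def, smul_eq_mul,
      Real.fourierChar_apply, inner_add_left, inner_smul_left]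
    rw [← mul_assoc, ← Complex.exp_add]
    congr 2
    simp
    ring

theorem fourierInv_translation (a : V) (f : Lp ℂ 2 (volume : Measure V)) :
    𝓕⁻ (translation a f) = modulation ((2 * Real.pi) • a) (𝓕⁻ f) := by
  refine DenseRange.induction_on
    (SchwartzMap.denseRange_toLpCLM (p := 2) ENNReal.ofNat_ne_top) f
    (isClosed_eq ?_ ?_) fun g => ?_
  · exact (Lp.fourierTransformₗᵢ V ℂ).symm.continuous.comp (translation a).continuous
  · exact (modulation _).continuous.comp (Lp.fourierTransformₗᵢ V ℂ).symm.continuous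
  · rw [toLpCLM_apply, translation_toLp, toLp_fourierInv_eq, toLp_fourierInv_eq]
    apply Lp.ext
    filter_upwards [coeFn_modulation ((2 * Real.pi) • a) ((𝓕⁻ g).toLp 2), (𝓕⁻ g).coeFn_toLp 2,
      (𝓕⁻ (g.compSubConstCLM ℂ a)).coeFn_toLp 2] with w h1 h2 h3
    rw [h1, h2, h3, fourierInv_coe, fourierInv_coe, Real.fourierInv_eq, Real.fourierInv_eq,
      ← integral_const_mul, ← integral_add_right_eq_self _ a]
    refine integral_congr_ae (Filter.Eventually.of_forall fun v => ?_)
    simp only [compSubConstCLM_apply, add_sub_cancel_right, Circle.smul_def, smul_eq_mul,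
      Real.fourierChar_apply, inner_add_left, inner_smul_left]
    rw [← mul_assoc, ← Complex.exp_add]
    congr 2
    simp
    ring

/-- The Fourier transform turns modulations into translations. -/
theorem fourier_modulation (b : V) (f : Lp ℂ 2 (volume : Measure V)) :
    𝓕 (modulation b f) = translation ((2 * Real.pi)⁻¹ • b) (𝓕 f) := by
  have h := fourierInv_translation ((2 * Real.pi)⁻¹ • b) (𝓕 f)
  rw [FourierTransform.fourierInv_fourier_eq, smul_smul,
    mul_inv_cancel₀ (by positivity : 2 * Real.pi ≠ 0), one_smul] at h
  rw [← h, FourierTransform.fourier_fourierInv_eq]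

/-- The canonical commutation relation between translations and modulations. -/
theorem translation_modulation (a b : V) (f : Lp ℂ 2 (volume : Measure V)) :
    translation a (modulation b f) =
      Complex.exp (-(Complex.I * (⟪b, a⟫_ℝ : ℂ))) • modulation b (translation a f) := by
  apply Lp.ext
  filter_upwards [coeFn_translation a (modulation b f), coeFn_modulation b (translation a f),
    coeFn_translation a f,
    (isometricWeight_translation a).quasiMeasurePreserving.ae (coeFn_modulation b f),
    Lp.coeFn_smul (Complex.exp (-(Complex.I * (⟪b, a⟫_ℝ : ℂ)))) (modulation b (translation a f))]
    with v h1 h2 h3 h4 h5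
  rw [h1, h4, h5, Pi.smul_apply, h2, h3, smul_eq_mul, ← mul_assoc, ← Complex.exp_add]
  congr 2
  rw [inner_sub_right]
  push_cast
  ring

end Fourier

end Unitaries

/-! ### Phase rotations and passive networks -/

section Phases

open FourierTransform

variable {ι : Type} [Fintype ι]

theorem re_ofReal_add_I_mul (a b : ℝ) : ((a : ℂ) + Complex.I * (b : ℂ)).re = a := by simp

theorem im_ofReal_add_I_mul (a b : ℝ) : ((a : ℂ) + Complex.I * (b : ℂ)).im = b := by simp

theorem isometricWeight_ofLp (ι : Type) [Fintype ι] :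
    IsometricWeight (volume : Measure (ι → ℝ)) (volume : Measure (EuclideanSpace ℝ ι))
      WithLp.ofLp (fun _ => 1) :=
  ⟨(PiLp.volume_preserving_ofLp ι).measurable, measurable_const, 1, one_ne_zero, fun _ => by simp,
    by rw [(PiLp.volume_preserving_ofLp ι).map_eq]; simp⟩

theorem isometricWeight_toLp (ι : Type) [Fintype ι] :
    IsometricWeight (volume : Measure (EuclideanSpace ℝ ι)) (volume : Measure (ι → ℝ))
      (WithLp.toLp 2) (fun _ => 1) :=
  ⟨(PiLp.volume_preserving_toLp ι).measurable, measurable_const, 1, one_ne_zero, fun _ => by simp,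
    by rw [(PiLp.volume_preserving_toLp ι).map_eq]; simp⟩

/-- The identification of the mode space with `L²` of the Euclidean space, on which Mathlib's
Fourier transform acts. -/
def toEuclideanL2 (ι : Type) [Fintype ι] :
    ModeSpace ι ≃ₗᵢ[ℂ] Lp ℂ 2 (volume : Measure (EuclideanSpace ℝ ι)) :=
  (isometricWeight_ofLp ι).toUnitary (isometricWeight_toLp ι) (fun _ => rfl) fun _ => one_mul 1

theorem coeFn_toEuclideanL2 (f : ModeSpace ι) :
    toEuclideanL2 ι f =ᵐ[volume] fun v => f v.ofLp := by
  filter_upwards [(isometricWeight_ofLp ι).coeFn_toUnitary (isometricWeight_toLp ι)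
    (fun _ => rfl) (fun _ => one_mul 1) f] with v h
  exact h.trans (one_mul _)

/-- A Weyl operator is a translation by `√2 Re z` followed by a modulation by `√2 Im z`, up to a
phase that makes it symmetric in the two. -/
theorem toEuclideanL2_weyl (z : ι → ℂ) (f : ModeSpace ι) :
    toEuclideanL2 ι (weyl z f) =
      Complex.exp (-(Complex.I * ((∑ j, (z j).re * (z j).im : ℝ) : ℂ))) •
        modulation (WithLp.toLp 2 fun j => √2 * (z j).im)
          (translation (WithLp.toLp 2 fun j => √2 * (z j).re) (toEuclideanL2 ι f)) := by
  set a : EuclideanSpace ℝ ι := WithLp.toLp 2 fun j => √2 * (z j).re with ha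
  set b : EuclideanSpace ℝ ι := WithLp.toLp 2 fun j => √2 * (z j).im with hb
  apply Lp.ext
  filter_upwards [coeFn_toEuclideanL2 (weyl z f),
    (isometricWeight_ofLp ι).quasiMeasurePreserving.ae (coeFn_weyl z f),
    Lp.coeFn_smul (Complex.exp (-(Complex.I * ((∑ j, (z j).re * (z j).im : ℝ) : ℂ))))
      (modulation b (translation a (toEuclideanL2 ι f))),
    coeFn_modulation b (translation a (toEuclideanL2 ι f)),
    coeFn_translation a (toEuclideanL2 ι f),
    (isometricWeight_translation a).quasiMeasurePreserving.ae (coeFn_toEuclideanL2 f)]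
    with v h1 h2 h3 h4 h5 h6
  rw [h1, h2, h3, Pi.smul_apply, h4, h5, h6, smul_eq_mul, ← mul_assoc]
  have e : weylPhase z v.ofLp = Complex.exp (-(Complex.I * ((∑ j, (z j).re * (z j).im : ℝ) : ℂ))) *
      Complex.exp (Complex.I * (⟪b, v⟫_ℝ : ℂ)) := by
    rw [weylPhase, ← Complex.exp_add, ← mul_neg, ← mul_add, ← Complex.ofReal_neg,
      ← Complex.ofReal_add, PiLp.inner_apply, ← Finset.sum_neg_distrib, ← Finset.sum_add_distrib]
    congr 3
    refine Finset.sum_congr rfl fun j _ => ?_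
    simp only [hb, RCLike.inner_apply, conj_trivial]
    ring
  rw [e]
  rfl

/-- The Fourier transform as a unitary of the mode space. With the normalization
`exp (-2πi x·ξ)` it maps `√2 z = a + i b` to `b / 2π - 2πi a`. -/
theorem exists_unitary_fourier (ι : Type) [Fintype ι] :
    ∃ U : ModeSpace ι ≃ₗᵢ[ℂ] ModeSpace ι, ∀ (z : ι → ℂ) (f : ModeSpace ι),
      U (weyl z f) = weyl (fun j => (((2 * Real.pi)⁻¹ * (z j).im : ℝ) : ℂ) +
        Complex.I * ((-(2 * Real.pi) * (z j).re : ℝ) : ℂ)) (U f) := by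
  refine ⟨((toEuclideanL2 ι).trans (Lp.fourierTransformₗᵢ _ ℂ)).trans (toEuclideanL2 ι).symm,
    fun z f => ?_⟩
  set z' : ι → ℂ := fun j => (((2 * Real.pi)⁻¹ * (z j).im : ℝ) : ℂ) +
        Complex.I * ((-(2 * Real.pi) * (z j).re : ℝ) : ℂ) with hz'
  have hre : ∀ j, (z' j).re = (2 * Real.pi)⁻¹ * (z j).im := fun j => by simp [hz']
  have him : ∀ j, (z' j).im = -(2 * Real.pi) * (z j).re := fun j => by simp [hz']
  have hpi : 2 * Real.pi ≠ 0 := by positivity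
  apply (toEuclideanL2 ι).injective
  rw [toEuclideanL2_weyl z']
  simp only [LinearIsometryEquiv.trans_apply, LinearIsometryEquiv.apply_symm_apply]
  rw [toEuclideanL2_weyl z, map_smul]
  set g := toEuclideanL2 ι f
  set a : EuclideanSpace ℝ ι := WithLp.toLp 2 fun j => √2 * (z j).re with ha
  set b : EuclideanSpace ℝ ι := WithLp.toLp 2 fun j => √2 * (z j).im with hb
  have ea : (WithLp.toLp 2 fun j => √2 * (z' j).im : EuclideanSpace ℝ ι) =
      -(2 * Real.pi) • a := by
    ext j; simp [ha, him]; ring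
  have eb : (WithLp.toLp 2 fun j => √2 * (z' j).re : EuclideanSpace ℝ ι) =
      (2 * Real.pi)⁻¹ • b := by
    ext j; simp [hb, hre]; ring
  rw [ea, eb]
  change _ • 𝓕 (modulation b (translation a g)) = _ • modulation _ (translation _ (𝓕 g))
  rw [fourier_modulation, fourier_translation, translation_modulation, smul_smul,
    ← Complex.exp_add]
  congr 2
  simp only [← mul_neg, ← mul_add, ← Complex.ofReal_neg, ← Complex.ofReal_add, inner_smul_left,
    inner_smul_right, PiLp.inner_apply, Finset.mul_sum, ← Finset.sum_neg_distrib,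
    ← Finset.sum_add_distrib]
  congr 2
  refine Finset.sum_congr rfl fun j _ => ?_
  rw [hre, him]
  simp only [ha, hb, RCLike.inner_apply, conj_trivial]
  have h2 : √(2 : ℝ) ^ 2 = 2 := Real.sq_sqrt zero_le_two
  field_simp
  rw [h2]
  ring

/-- The Fourier conjugate of a chirp is a shear of the positions. -/
theorem exists_unitary_shear (t : ι → ℝ) :
    ∃ U : ModeSpace ι ≃ₗᵢ[ℂ] ModeSpace ι, ∀ (z : ι → ℂ) (f : ModeSpace ι),
      weyl z (U f) = U (weyl (fun j =>
        (((z j).re + t j * (z j).im : ℝ) : ℂ) + Complex.I * ((z j).im : ℂ)) f) := by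
  obtain ⟨F, hF⟩ := exists_unitary_fourier ι
  -- the factor `(2π)²` undoes the scaling of both quadratures by the Fourier transform
  obtain ⟨C, hC⟩ := exists_unitary_chirp fun j => (2 * Real.pi) ^ 2 * t j
  refine ⟨(F.trans C).trans F.symm, fun z f => ?_⟩
  apply F.injective
  rw [hF]
  simp only [LinearIsometryEquiv.trans_apply, LinearIsometryEquiv.apply_symm_apply]
  rw [hC, hF]
  congr 2
  ext j
  have hpi : Real.pi ≠ 0 := Real.pi_ne_zero
  apply Complex.ext
  · simp only [re_ofReal_add_I_mul, im_ofReal_add_I_mul]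
  · simp only [re_ofReal_add_I_mul, im_ofReal_add_I_mul]
    field_simp
    ring

/-- Independent phase rotations `a_j ↦ e_j a_j` of the modes, as a product of three shears:
a rotation by `θ` is the product of shears with parameters `tan (θ/2)`, `sin θ`, `tan (θ/2)`,
which requires `e_j ≠ -1`. -/
theorem exists_unitary_phase {e : ι → ℂ} (he : ∀ j, ‖e j‖ = 1) (he' : ∀ j, 1 + (e j).re ≠ 0) :
    ∃ U : ModeSpace ι ≃ₗᵢ[ℂ] ModeSpace ι, ∀ (z : ι → ℂ) (f : ModeSpace ι),
      weyl z (U f) = U (weyl (fun j => z j * conj (e j)) f) := by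
  -- `tan (θ/2) = sin θ / (1 + cos θ)`
  obtain ⟨C, hC⟩ := exists_unitary_chirp fun j => (e j).im / (1 + (e j).re)
  obtain ⟨S, hS⟩ := exists_unitary_shear fun j => (e j).im
  refine ⟨(C.trans S).trans C, fun z f => ?_⟩
  simp only [LinearIsometryEquiv.trans_apply]
  rw [hC, hS, hC]
  congr 4
  ext j
  have h1 : (e j).re ^ 2 + (e j).im ^ 2 = 1 := by
    have := Complex.sq_norm (e j)
    rw [he, Complex.normSq_apply] at this
    linarith
  have h2 := he' j
  apply Complex.ext
  · simp only [re_ofReal_add_I_mul, im_ofReal_add_I_mul, Complex.mul_re, Complex.conj_re,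
      Complex.conj_im]
    field_simp
    linear_combination (-(z j).re) * h1
  · simp only [re_ofReal_add_I_mul, im_ofReal_add_I_mul, Complex.mul_im, Complex.conj_re,
      Complex.conj_im]
    field_simp
    linear_combination (z j).re * (e j).im * h1 - (z j).im * (1 + (e j).re) * h1

/-- The canonical unitary of a passive network that is a real orthogonal matrix `O` preceded by
phase rotations. -/
theorem exists_unitary_passive {κ : Type} [Fintype κ] [DecidableEq ι] [DecidableEq κ]
    {O : Matrix κ ι ℝ} (h1 : O.transpose * O = 1) (h2 : O * O.transpose = 1) {e : ι → ℂ}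
    (he : ∀ j, ‖e j‖ = 1) (he' : ∀ j, 1 + (e j).re ≠ 0) :
    ∃ U : ModeSpace ι ≃ₗᵢ[ℂ] ModeSpace κ,
      ImplementsBogoliubov U (Matrix.of fun i j => (O i j : ℂ) * e j) 0 := by
  obtain ⟨U, hU⟩ := exists_unitary_linear h1 h2
  obtain ⟨V, hV⟩ := exists_unitary_phase he he'
  refine ⟨V.trans U, fun z f => ?_⟩
  simp only [LinearIsometryEquiv.trans_apply]
  rw [hU, hV]
  congr 3
  ext j
  rw [Finset.sum_mul]
  refine Finset.sum_congr rfl fun i _ => ?_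
  simp only [Matrix.of_apply, Matrix.zero_apply, mul_zero, sub_zero, map_mul, Complex.conj_ofReal]
  rw [← mul_assoc]
  congr 1
  apply Complex.ext <;> simp

/-- A squeezing transformation `x ↦ A x`, `p ↦ B p` with `B = (A⁻¹)ᵀ` has the Bogoliubov matrices
`(A + B) / 2` and `(A - B) / 2`. -/
theorem exists_unitary_squeezing {κ : Type} [Fintype κ] [DecidableEq ι] [DecidableEq κ]
    {A B : Matrix κ ι ℝ} (hBA : B.transpose * A = 1) (hAB : A * B.transpose = 1) :
    ∃ U : ModeSpace ι ≃ₗᵢ[ℂ] ModeSpace κ,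
      ImplementsBogoliubov U (Matrix.of fun i j => (((A i j + B i j) / 2 : ℝ) : ℂ))
        (Matrix.of fun i j => (((A i j - B i j) / 2 : ℝ) : ℂ)) := by
  obtain ⟨U, hU⟩ := exists_unitary_linear hBA hAB
  refine ⟨U, fun z f => ?_⟩
  rw [hU]
  congr 2
  ext j
  refine Finset.sum_congr rfl fun i _ => ?_
  simp only [Matrix.of_apply, Complex.conj_ofReal]
  apply Complex.ext <;> simp <;> ring

end Phases

/-! ### Beamsplitters and single-mode channels -/

section Channels

/-- A unit vector is the first row of an orthogonal matrix. -/
theorem exists_orthogonal_row {ι κ : Type} [Fintype ι] [Fintype κ] [DecidableEq ι] [DecidableEq κ]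
    (hcard : Fintype.card κ = Fintype.card ι) (i₀ : κ) {r : ι → ℝ} (hr : ∑ j, r j ^ 2 = 1) :
    ∃ O : Matrix κ ι ℝ, O.transpose * O = 1 ∧ O * O.transpose = 1 ∧ ∀ j, O i₀ j = r j := by
  have hnorm : ‖(WithLp.toLp 2 r : EuclideanSpace ℝ ι)‖ = 1 := by
    rw [EuclideanSpace.norm_eq]
    simp [hr]
  obtain ⟨b, hb⟩ := Orthonormal.exists_orthonormalBasis_extension_of_card_eq (𝕜 := ℝ)
    (E := EuclideanSpace ℝ ι) (ι := κ) (by rw [finrank_euclideanSpace, hcard])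
    (v := fun _ => WithLp.toLp 2 r) (s := {i₀}) (by
      rw [orthonormal_iff_ite]
      rintro ⟨i, rfl⟩ ⟨j, rfl⟩
      simp [Set.domRestrict, hnorm])
  have h1 : (Matrix.of fun i j => b i j) * (Matrix.of fun i j => b i j).transpose = 1 := by
    ext i k
    have := orthonormal_iff_ite.1 b.orthonormal i k
    rw [PiLp.inner_apply] at this
    rw [Matrix.mul_apply, Matrix.one_apply, ← this]
    exact Finset.sum_congr rfl fun j _ => by simp [mul_comm]
  refine ⟨Matrix.of fun i j => b i j, ?_, h1, fun j => ?_⟩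
  · exact (Matrix.mul_eq_one_comm_of_card_eq _ _ _ hcard).1 h1
  · rw [Matrix.of_apply, hb i₀ rfl]

/-- Vectors with `α ⬝ᵥ β = 1` are the first rows of a matrix and of its contragredient. With an
orthonormal basis `b` that extends `β / ‖β‖`, the other rows can be taken to be `b i` and
`b i - (α ⬝ᵥ b i) β`. -/
theorem exists_contragredient_rows {ι : Type} [Fintype ι] [DecidableEq ι] (i₀ : ι) {α β : ι → ℝ}
    (h : α ⬝ᵥ β = 1) :
    ∃ A B : Matrix ι ι ℝ, B.transpose * A = 1 ∧ A * B.transpose = 1 ∧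
      (∀ j, A i₀ j = α j) ∧ ∀ j, B i₀ j = β j := by
  have hβ : 0 < ∑ j, β j ^ 2 := by
    refine lt_of_le_of_ne (Finset.sum_nonneg fun j _ => sq_nonneg _) fun h0 => ?_
    have h1 := (Finset.sum_eq_zero_iff_of_nonneg fun j _ => sq_nonneg (β j)).1 h0.symm
    have h2 : β = 0 := funext fun j => pow_eq_zero_iff two_ne_zero |>.1 (h1 j (Finset.mem_univ j))
    rw [h2, dotProduct_zero] at h
    exact zero_ne_one h
  set n := √(∑ j, β j ^ 2) with hn
  have hn0 : n ≠ 0 := (Real.sqrt_pos.2 hβ).ne'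
  obtain ⟨O, -, hO, hO₀⟩ := exists_orthogonal_row rfl i₀ (r := fun j => β j / n) (by
    simp only [div_pow]
    rw [← Finset.sum_div, hn, Real.sq_sqrt hβ.le, div_self hβ.ne'])
  have hOO : ∀ i k, O i ⬝ᵥ O k = if i = k then 1 else 0 := fun i k => by
    rw [← Matrix.one_apply, ← hO]; rfl
  have hβO : β = n • O i₀ := by
    ext j
    rw [Pi.smul_apply, hO₀, smul_eq_mul, mul_div_cancel₀ _ hn0]
  have hOβ : ∀ i, i ≠ i₀ → O i ⬝ᵥ β = 0 := fun i hi => by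
    rw [hβO, dotProduct_smul, hOO, if_neg hi, smul_zero]
  let A : Matrix ι ι ℝ := Matrix.of fun i => if i = i₀ then α else O i
  let B : Matrix ι ι ℝ := Matrix.of fun i => if i = i₀ then β else O i - (α ⬝ᵥ O i) • β
  have hAB : A * B.transpose = 1 := by
    ext i k
    have e : (A * B.transpose) i k =
        (if i = i₀ then α else O i) ⬝ᵥ (if k = i₀ then β else O k - (α ⬝ᵥ O k) • β) := rfl
    rw [e, Matrix.one_apply]
    by_cases hi : i = i₀ <;> by_cases hk : k = i₀
    · simp [hi, hk, h]
    · simp [hi, hk, h, Ne.symm hk]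
    · simp [hi, hk, hOβ i hi]
    · simp [hi, hk, hOβ i hi, hOO]
  refine ⟨A, B, (Matrix.mul_eq_one_comm_of_card_eq _ _ _ rfl).1 hAB, hAB, fun j => ?_, fun j => ?_⟩
  · simp [A]
  · simp [B]

/-- Every complex number is a real number times a phase different from `-1`: a negative real number
takes its sign into the real factor. -/
theorem exists_real_mul_phase (c : ℂ) :
    ∃ (r : ℝ) (e : ℂ), ‖e‖ = 1 ∧ 1 + e.re ≠ 0 ∧ (r : ℂ) * e = c ∧ r ^ 2 = ‖c‖ ^ 2 := by
  by_cases hc : c = 0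
  · exact ⟨0, 1, by simp, by norm_num, by simp [hc], by simp [hc]⟩
  have hn : (‖c‖ : ℂ) ≠ 0 := by simpa using hc
  by_cases h : 1 + (c / ‖c‖).re = 0
  · refine ⟨-‖c‖, -(c / ‖c‖), by simp [hc], fun h' => ?_, ?_, by ring⟩
    · rw [Complex.neg_re] at h'
      linarith
    · push_cast
      field_simp
  · exact ⟨‖c‖, c / ‖c‖, by simp [hc], h, by field_simp, rfl⟩

theorem exists_isBeamsplitter {s : ℕ} {v : Fin s → ℂ} (hv : ∑ k, ‖v k‖ ^ 2 = 1) :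
    ∃ B : StateMap (Fin s) (Fin 1), IsBeamsplitter v B := by
  obtain ⟨m, rfl⟩ : ∃ m, s = 1 + m := by
    cases s with
    | zero => simp at hv
    | succ m => exact ⟨m, add_comm m 1⟩
  choose r e he he' hre hr using fun k => exists_real_mul_phase (v k)
  obtain ⟨O, h1, h2, hO⟩ := exists_orthogonal_row (ι := Fin (1 + m)) (κ := Fin 1 ⊕ Fin m) (by simp)
    (Sum.inl 0) (r := r) (by simpa only [hr] using hv)
  obtain ⟨U, hU⟩ := exists_unitary_passive h1 h2 he he'
  obtain ⟨B, hB⟩ := exists_hasDilation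
    (W := U.toLinearIsometry.toContinuousLinearMap) fun f => U.norm_map f
  set P : Matrix (Fin 1 ⊕ Fin m) (Fin (1 + m)) ℂ := Matrix.of fun i j => (O i j : ℂ) * e j with hP
  have hee : ∀ j, e j * conj (e j) = 1 := fun j => by
    rw [Complex.mul_conj, Complex.normSq_eq_norm_sq, he]; simp
  have hPP : P * P.conjTranspose = 1 := by
    ext i k
    have h3 := congrFun (congrFun h2 i) k
    rw [Matrix.mul_apply, Matrix.one_apply] at h3
    rw [Matrix.mul_apply, Matrix.one_apply]
    have h4 : ∀ j, P i j * P.conjTranspose j k = ((O i j * O.transpose j k : ℝ) : ℂ) := fun j => by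
      simp only [hP, Matrix.conjTranspose_apply, Matrix.of_apply, Matrix.transpose_apply,
        RCLike.star_def, map_mul, Complex.conj_ofReal, Complex.ofReal_mul]
      linear_combination (O i j * O k j : ℂ) * hee j
    simp only [h4, ← Complex.ofReal_sum, h3]
    split_ifs <;> simp
  refine ⟨B, m, U, P, hPP, (Matrix.mul_eq_one_comm_of_card_eq _ _ _ (by simp)).1 hPP, fun k => ?_,
    hU, hB⟩
  rw [hP, Matrix.of_apply, hO, hre]

/-- The action of a beamsplitter on characteristic functions. -/
theorem IsBeamsplitter.charFn_eq {s : ℕ} {v : Fin s → ℂ} {B : StateMap (Fin s) (Fin 1)}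
    (hB : IsBeamsplitter v B) (ρ : DensityOperator (ModeSpace (Fin s))) (z : Fin 1 → ℂ) :
    (B ρ).charFn z = ρ.charFn fun k => z 0 * conj (v k) := by
  obtain ⟨m, U, P, -, -, hP, hU, hN⟩ := hB
  rw [hN.charFn_of_unitary hU]
  simp [hP]

/-- The vacuum expectation of `exp (z b† - z̄ b)` with `b = u₁ a_{E,1} + u₂ a_{E,2}†`, the
environment's contribution to the receiver's mode. -/
def environmentFactor (u₁ u₂ : ℝ) (z : ℂ) : ℂ :=
  ⟪vacuum (Fin 2), weyl ![z * u₁, -(conj z * u₂)] (vacuum (Fin 2))⟫_ℂ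

/-- The action of a phase-insensitive Gaussian multiple-access channel on characteristic functions:
it depends on the dilation only through the weights and the environment coefficients. -/
theorem charFn_of_gaussian_dilation {s m : ℕ} {N : StateMap (Fin s) (Fin 1)} {p q : Fin s → ℂ}
    {u₁ u₂ : ℝ} {U : ModeSpace (Fin s ⊕ Fin 2) ≃ₗᵢ[ℂ] ModeSpace (Fin 1 ⊕ Fin m)}
    {P Q : Matrix (Fin 1 ⊕ Fin m) (Fin s ⊕ Fin 2) ℂ}
    (hp : ∀ k, P (Sum.inl 0) (Sum.inl k) = p k) (hq : ∀ k, Q (Sum.inl 0) (Sum.inl k) = q k)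
    (hP0 : P (Sum.inl 0) (Sum.inr 0) = u₁) (hP1 : P (Sum.inl 0) (Sum.inr 1) = 0)
    (hQ0 : Q (Sum.inl 0) (Sum.inr 0) = 0) (hQ1 : Q (Sum.inl 0) (Sum.inr 1) = u₂)
    (hU : ImplementsBogoliubov U P Q)
    (hN : HasDilation N
      (U.toLinearIsometry.toContinuousLinearMap ∘L tensorRight (Fin s) (vacuum (Fin 2))))
    (ρ : DensityOperator (ModeSpace (Fin s))) (z : Fin 1 → ℂ) :
    (N ρ).charFn z = environmentFactor u₁ u₂ (z 0) *
      ρ.charFn fun k => z 0 * conj (p k) - conj (z 0) * q k := by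
  rw [hN.charFn_of_vacuum hU, environmentFactor]
  congr 1
  · congr 2
    ext j
    fin_cases j
    · simp [hP0, hQ0]
    · simp [hP1, hQ1]
  · simp [hp, hq]

/-- Existence of the single-mode phase-insensitive Gaussian channel with real coefficient `c`, with
prescribed environment coefficients. All Bogoliubov coefficients are real, so a change of position
coordinates implements it; the sum and the difference of the coefficient rows pair to one by the
commutation relation. -/
theorem exists_isBGC (δ : Fin 2) {c NB u₁ u₂ : ℝ}
    (h1 : (1 - 2 * ((δ : ℕ) : ℝ)) * c ^ 2 + (u₁ ^ 2 - u₂ ^ 2) = 1)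
    (h2 : NB = u₂ ^ 2 + c ^ 2 * ((δ : ℕ) : ℝ)) :
    ∃ Ψ : StateMap (Fin 1) (Fin 1), IsBGC δ c NB Ψ ∧
      ∀ (ρ : DensityOperator (ModeSpace (Fin 1))) (z : Fin 1 → ℂ),
        (Ψ ρ).charFn z = environmentFactor u₁ u₂ (z 0) *
          ρ.charFn fun _ => z 0 * conj ((c : ℂ) * (1 - ((δ : ℕ) : ℂ))) -
            conj (z 0) * ((c : ℂ) * ((δ : ℕ) : ℂ)) := by
  set d : ℝ := ((δ : ℕ) : ℝ) with hd
  have hdc : ((δ : ℕ) : ℂ) = (d : ℂ) := by simp [hd]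
  obtain ⟨A, B, hBA, hAB, hA, hB⟩ := exists_contragredient_rows (ι := Fin 1 ⊕ Fin 2) (Sum.inl 0)
    (α := Sum.elim (fun _ => c) ![u₁, u₂]) (β := Sum.elim (fun _ => c * (1 - 2 * d)) ![u₁, -u₂])
    (by
      simp only [dotProduct, Fintype.sum_sum_type, Sum.elim_inl, Sum.elim_inr,
        Finset.univ_unique, Finset.sum_singleton, Fin.sum_univ_two, Matrix.cons_val_zero,
        Matrix.cons_val_one]
      linear_combination h1)
  obtain ⟨U, hU⟩ := exists_unitary_squeezing hBA hAB
  obtain ⟨Ψ, hΨ⟩ := exists_hasDilation (W := U.toLinearIsometry.toContinuousLinearMap ∘L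
    tensorRight (Fin 1) (vacuum (Fin 2))) fun f => by
      change ‖U (tensorVec f (vacuum (Fin 2)))‖ = ‖f‖
      rw [U.norm_map, norm_tensorVec, norm_vacuum, mul_one]
  set P : Matrix (Fin 1 ⊕ Fin 2) (Fin 1 ⊕ Fin 2) ℂ :=
    Matrix.of fun i j => (((A i j + B i j) / 2 : ℝ) : ℂ) with hP
  set Q : Matrix (Fin 1 ⊕ Fin 2) (Fin 1 ⊕ Fin 2) ℂ :=
    Matrix.of fun i j => (((A i j - B i j) / 2 : ℝ) : ℂ) with hQ
  have hp : ∀ k, P (Sum.inl 0) (Sum.inl k) = c * (1 - ((δ : ℕ) : ℂ)) := fun k => by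
    simp only [hP, Matrix.of_apply, hA, hB, Sum.elim_inl, hdc]
    push_cast
    ring
  have hq : ∀ k, Q (Sum.inl 0) (Sum.inl k) = c * ((δ : ℕ) : ℂ) := fun k => by
    simp only [hQ, Matrix.of_apply, hA, hB, Sum.elim_inl, hdc]
    push_cast
    ring
  have hP0 : P (Sum.inl 0) (Sum.inr 0) = u₁ := by simp [hP, hA, hB]
  have hP1 : P (Sum.inl 0) (Sum.inr 1) = 0 := by simp [hP, hA, hB]
  have hQ0 : Q (Sum.inl 0) (Sum.inr 0) = 0 := by simp [hQ, hA, hB]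
  have hQ1 : Q (Sum.inl 0) (Sum.inr 1) = u₂ := by simp [hQ, hA, hB]
  refine ⟨Ψ, ⟨u₁, u₂, 2, U, P, Q, ?_, ?_, hp, hq, hP0, hP1, hQ0, hQ1, hU, hΨ⟩,
    charFn_of_gaussian_dilation hp hq hP0 hP1 hQ0 hQ1 hU hΨ⟩
  · simpa using h1
  · simpa using h2

/-- A channel all of whose senders have the same symmetry type factors through a beamsplitter. The
hypothesis `hvw` says that mixing with `v` and then transforming with coefficient `c` gives
the weights `w` on each sender. -/
theorem IsBGMAC.isInterferenceBGMAC {s : ℕ} {δ : Fin 2} {w v : Fin s → ℂ} {NB c : ℝ}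
    {N : StateMap (Fin s) (Fin 1)} (hN : IsBGMAC (fun _ => δ) w NB N)
    (hc : c ^ 2 = ∑ k, ‖w k‖ ^ 2) (hv : ∑ k, ‖v k‖ ^ 2 = 1)
    (hvw : ∀ (z : ℂ) k, (z * conj ((c : ℂ) * (1 - ((δ : ℕ) : ℂ))) -
        conj z * ((c : ℂ) * ((δ : ℕ) : ℂ))) * conj (v k) =
      z * conj (w k * (1 - ((δ : ℕ) : ℂ))) - conj z * (w k * ((δ : ℕ) : ℂ))) :
    IsInterferenceBGMAC δ v c NB N := by
  obtain ⟨u₁, u₂, m, U, P, Q, h1, h2, hp, hq, hP0, hP1, hQ0, hQ1, hU, hD⟩ := hN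
  rw [← Finset.mul_sum, ← hc] at h1
  rw [← Finset.sum_mul, ← hc] at h2
  obtain ⟨B, hB⟩ := exists_isBeamsplitter hv
  obtain ⟨Ψ, hΨ, hΨ'⟩ := exists_isBGC δ h1 h2
  refine ⟨B, Ψ, hB, hΨ, funext fun ρ => DensityOperator.ext_charFn fun z => ?_⟩
  rw [charFn_of_gaussian_dilation hp hq hP0 hP1 hQ0 hQ1 hU hD, Function.comp_apply, hΨ',
    hB.charFn_eq]
  simp only [hvw]

/-- Normalized weights; for `w = 0` any unit vector will do. -/
theorem exists_unit_direction {s : ℕ} (hs : 1 ≤ s) (w : Fin s → ℂ) :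
    ∃ v : Fin s → ℂ, (∀ k, ((√(∑ l, ‖w l‖ ^ 2) : ℝ) : ℂ) * v k = w k) ∧ ∑ k, ‖v k‖ ^ 2 = 1 := by
  have hnn : 0 ≤ ∑ l, ‖w l‖ ^ 2 := Finset.sum_nonneg fun _ _ => sq_nonneg _
  by_cases h0 : ∑ l, ‖w l‖ ^ 2 = 0
  · refine ⟨Pi.single ⟨0, hs⟩ 1, fun k => ?_, ?_⟩
    · have := (Finset.sum_eq_zero_iff_of_nonneg fun l _ => sq_nonneg ‖w l‖).1 h0 k
        (Finset.mem_univ k)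
      rw [h0, Real.sqrt_zero, Complex.ofReal_zero, zero_mul]
      exact (norm_eq_zero.1 (pow_eq_zero_iff two_ne_zero |>.1 this)).symm
    · rw [Finset.sum_eq_single ⟨0, hs⟩]
      · simp
      · intro k _ hk
        simp [Pi.single_eq_of_ne hk]
      · simp
  · have hc : √(∑ l, ‖w l‖ ^ 2) ≠ 0 := fun h => h0 ((Real.sqrt_eq_zero hnn).1 h)
    refine ⟨fun k => w k / (√(∑ l, ‖w l‖ ^ 2) : ℝ), fun k => ?_, ?_⟩
    · rw [mul_div_cancel₀]
      exact_mod_cast hc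
    · simp only [norm_div, div_pow, Complex.norm_real, Real.norm_eq_abs, sq_abs]
      rw [← Finset.sum_div, Real.sq_sqrt hnn, div_self h0]

end Channels

end

theorem mainTheorem9 {s : ℕ} (hs : 1 ≤ s) (w : Fin s → ℂ) (NB : ℝ)
    (N : StateMap (Fin s) (Fin 1)) :
    (IsBGMAC (fun _ => 0) w NB N →
      ∃ v : Fin s → ℂ, (∀ k, ((√(∑ l, ‖w l‖ ^ 2) : ℝ) : ℂ) * v k = w k) ∧
        IsInterferenceBGMAC 0 v ((√(∑ l, ‖w l‖ ^ 2) : ℝ) : ℂ) NB N) ∧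
    (IsBGMAC (fun _ => 1) w NB N →
      ∃ v : Fin s → ℂ, (∀ k, ((√(∑ l, ‖w l‖ ^ 2) : ℝ) : ℂ) * v k = conj (w k)) ∧
        IsInterferenceBGMAC 1 v ((√(∑ l, ‖w l‖ ^ 2) : ℝ) : ℂ) NB N) := by
  have hc : √(∑ l, ‖w l‖ ^ 2) ^ 2 = ∑ l, ‖w l‖ ^ 2 :=
    Real.sq_sqrt (Finset.sum_nonneg fun _ _ => sq_nonneg _)
  refine ⟨fun hN => ?_, fun hN => ?_⟩
  · obtain ⟨v, hv, hv1⟩ := exists_unit_direction hs w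
    refine ⟨v, hv, hN.isInterferenceBGMAC hc hv1 fun z k => ?_⟩
    rw [← hv k]
    simp [mul_assoc]
  · obtain ⟨v, hv, hv1⟩ := exists_unit_direction hs fun k => conj (w k)
    simp only [RCLike.norm_conj] at hv
    refine ⟨v, hv, hN.isInterferenceBGMAC hc hv1 fun z k => ?_⟩
    have hw : w k = ((√(∑ l, ‖w l‖ ^ 2) : ℝ) : ℂ) * conj (v k) := by
      rw [← Complex.conj_conj (w k), ← hv k, map_mul, Complex.conj_ofReal]
    rw [hw]
    simp [mul_assoc]
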